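/- **Adapted Fourier coefficient map.** Let $e_k(x)=e^{k\pi i x}$. For $q=\sum_{n\in\mathbb Z}q_ne_{2n}\in L^2(\mathbb R/\mathbb Z,\mathbb C)$ put $\|q\|_o^2=\sum|q_n|^2$. A normalized weight is a function $w:\mathbb Z\to\mathbb R$ with $w_n=w_{-n}\ge1$; it is submultiplicative if $w_{n+k}\le w_nw_k$ for all $n,k$. Let $\mathcal H^w$ be the space of all $q\in L^2(\mathbb R/\mathbb Z,\mathbb C)$ with mean value $q_0=0$ and $\|q\|_w^2=\sum w_n^2|q_n|^2<\infty$, let $\mathcal H^o$ be the case $w\equiv1$, and let $B_m^w=\{q\in\mathcal H^w:4\|q\|_w\le m\}$, $B^o_m=\{q\in\mathcal H^o:4\|q\|_o\le m\}$. For $n\ge1$, $\lambda\in U_n=\{\lambda\in\mathbb C:|\operatorname{Re}\lambda-n^2\pi^2|\le12n\}$ and $q\in\mathcal H^o$, let $V$ be multiplication by $q$, and define on the $L^2$ functions $f=\sum_k f_ke_k$ of period 2 the operator $$T_nf=\sum_{|k|\ne n}\frac{f_k}{\lambda-k^2\pi^2}\,Ve_k .$$ Where $I-T_n$ is invertible,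 put $$a_n(\lambda,q)=\langle (I-T_n)^{-1}Ve_n,e_n\rangle,\qquad c_{\pm n}(\lambda,q)=\langle (I-T_n)^{-1}Ve_{\mp n},e_{\pm n}\rangle ,$$ where $\langle f,e_k\rangle$ is the $k$-th Fourier coefficient of $f=\sum_k f_ke_k$ (so $c_{\pm n}=q_{\pm n}+\dots$). Let $m\ge1$ be real, and $M_m=2^{10}m^2$. For each integer $n\ge M_m$ and $q\in B^o_m$, the operator $I-T_n$ is invertible for all $\lambda\in U_n$, and there is exactly one $\lambda=\alpha_n(q)\in U_n$ with $\lambda=n^2\pi^2+a_n(\lambda,q)$. Put $\alpha_{-n}=\alpha_n$ and $$\Phi_m(q)=\sum_{|n|<M_m}q_ne_{2n}+\sum_{|n|\ge M_m}c_n(\alpha_n(q),q)\,e_{2n}.$$ Then this series converges in $L^2$ for each $q\in B^o_m$, and $\Phi_m$ maps $B_m^o$ into $\mathcal H^o$; moreover $\Phi_m(q)$ is real-valued if and only if $q$ is. For every submultiplicative normalized weight $w$, $\Phi_m$ maps $B_m^w$ into $\mathcal H^w$, and its restriction $B_m^w\to\Phi_m(B_m^w)\subset\mathcal H^w$ is an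 analytic diffeomorphism: $\Phi_m$ is given by the same formula and complex analytic, as a map into $\mathcal H^w$, near each point of the closed ball $B_m^w$; it is one-to-one on $B^w_m$; and its inverse extends to a complex analytic map near each point of $\Phi_m(B_m^w)$. Furthermore, for all $q\in B_m^w$, $$\tfrac12\|q\|_w\le\|\Phi_m(q)\|_w\le2\|q\|_w,\qquad \|D\Phi_m(q)-I\|\le\tfrac18$$ with the operator norm on $\mathcal H^w$. -/

import Mathlib

open MeasureTheory AddCircle

/-- Complex `L²` functions of period `T`, with respect to the normalised measure on a period. -/
abbrev PerL2 (T : ℝ) [Fact (0 < T)] : Type :=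
  Lp ℂ 2 (haarAddCircle (T := T))

/-! ### Weights and weighted Sobolev spaces -/

/-- A normalized weight: `w_n = w_{-n} ≥ 1`. -/
structure NormalizedWeight where
  val : ℤ → ℝ
  symm : ∀ n, val (-n) = val n
  one_le : ∀ n, 1 ≤ val n

/-- `w_{n+m} ≤ w_n w_m`. -/
def NormalizedWeight.Submultiplicative (w : NormalizedWeight) : Prop :=
  ∀ n m : ℤ, w.val (n + m) ≤ w.val n * w.val m

theorem fourierCoeff_add_Lp (f g : PerL2 1) (n : ℤ) :
    fourierCoeff (f + g : PerL2 1) n = fourierCoeff f n + fourierCoeff g n := by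
  simp only [← fourierBasis_repr, map_add, lp.coeFn_add, Pi.add_apply]

theorem fourierCoeff_smul_Lp (a : ℂ) (f : PerL2 1) (n : ℤ) :
    fourierCoeff (a • f : PerL2 1) n = a * fourierCoeff f n := by
  simp only [← fourierBasis_repr, map_smul, lp.coeFn_smul, Pi.smul_apply, smul_eq_mul]

theorem memlp_weighted_iff (w : NormalizedWeight) (f : PerL2 1) :
    Memℓp (fun n : ℤ => (w.val n : ℂ) * fourierCoeff f n) 2 ↔
      Summable fun n : ℤ => w.val n ^ 2 * ‖fourierCoeff f n‖ ^ 2 := by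
  rw [memℓp_gen_iff (by norm_num)]
  refine summable_congr fun n => ?_
  simp [mul_pow]

/-- The 1-periodic `L²` functions of mean value zero and finite `w`-norm. -/
def hwSubmodule (w : NormalizedWeight) : Submodule ℂ (PerL2 1) where
  carrier := {q | fourierCoeff q 0 = 0 ∧
    Summable fun n : ℤ => w.val n ^ 2 * ‖fourierCoeff q n‖ ^ 2}
  zero_mem' := by
    have h : ∀ n : ℤ, fourierCoeff (0 : PerL2 1) n = 0 := fun n => by
      simpa using fourierCoeff_smul_Lp 0 0 n
    refine ⟨h 0, ?_⟩
    simp only [h]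
    simp
  add_mem' := by
    rintro f g ⟨hf0, hf⟩ ⟨hg0, hg⟩
    refine ⟨by rw [fourierCoeff_add_Lp, hf0, hg0, add_zero], ?_⟩
    rw [← memlp_weighted_iff] at hf hg ⊢
    have := hf.add hg
    convert this using 1
    funext n
    simp only [Pi.add_apply, fourierCoeff_add_Lp, mul_add]
  smul_mem' := by
    rintro a f ⟨hf0, hf⟩
    refine ⟨by rw [fourierCoeff_smul_Lp, hf0, mul_zero], ?_⟩
    rw [← memlp_weighted_iff] at hf ⊢
    have := hf.const_smul a
    convert this using 1
    funext n
    simp only [Pi.smul_apply, fourierCoeff_smul_Lp, smul_eq_mul]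
    ring

/-- The space `H^w` of potentials of mean value zero.  It is a type of its own, because it carries
the `w`-norm and not the `L²` norm. -/
def Hw (w : NormalizedWeight) : Type := ↥(hwSubmodule w)

namespace Hw

noncomputable instance (w : NormalizedWeight) : AddCommGroup (Hw w) :=
  inferInstanceAs (AddCommGroup ↥(hwSubmodule w))

noncomputable instance (w : NormalizedWeight) : Module ℂ (Hw w) :=
  inferInstanceAs (Module ℂ ↥(hwSubmodule w))

/-- An element of `H^w` as an `L²` function. -/
def toL2 {w : NormalizedWeight} (q : Hw w) : PerL2 1 := Subtype.val q

/-- The sequence `(w_n q_n)`, whose `ℓ²` norm is the `w`-norm. -/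
noncomputable def weightedCoeff (w : NormalizedWeight) : Hw w →ₗ[ℂ] lp (fun _ : ℤ => ℂ) 2 where
  toFun q := ⟨fun n : ℤ => (w.val n : ℂ) * fourierCoeff q.toL2 n,
    (memlp_weighted_iff w q.toL2).2 q.property.2⟩
  map_add' f g := by
    ext n
    change (w.val n : ℂ) * fourierCoeff (f.toL2 + g.toL2 : PerL2 1) n = _ * _ + _ * _
    rw [fourierCoeff_add_Lp, mul_add]
  map_smul' a f := by
    ext n
    change (w.val n : ℂ) * fourierCoeff (a • f.toL2 : PerL2 1) n = a * (_ * _)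
    rw [fourierCoeff_smul_Lp]
    ring

theorem weightedCoeff_injective (w : NormalizedWeight) :
    Function.Injective (weightedCoeff w) := by
  intro f g h
  apply Subtype.ext
  apply (fourierBasis (T := (1 : ℝ))).repr.injective
  ext n
  have hn : (w.val n : ℂ) * fourierCoeff f.toL2 n = (w.val n : ℂ) * fourierCoeff g.toL2 n :=
    congrArg (fun s : lp (fun _ : ℤ => ℂ) 2 => s n) h
  have hw : (w.val n : ℂ) ≠ 0 := by
    have := w.one_le n
    exact_mod_cast (by linarith : (0 : ℝ) < w.val n).ne'
  rw [fourierBasis_repr, fourierBasis_repr]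
  exact mul_left_cancel₀ hw hn

noncomputable instance (w : NormalizedWeight) : NormedAddCommGroup (Hw w) :=
  NormedAddCommGroup.induced (Hw w) (lp (fun _ : ℤ => ℂ) 2) (weightedCoeff w)
    (weightedCoeff_injective w)

noncomputable instance (w : NormalizedWeight) : NormedSpace ℂ (Hw w) :=
  NormedSpace.induced ℂ (Hw w) (lp (fun _ : ℤ => ℂ) 2) (weightedCoeff w)

/-- `‖q‖_w² = ∑ w_n² |q_n|²`. -/
theorem norm_sq_eq {w : NormalizedWeight} (q : Hw w) :
    ‖q‖ ^ 2 = ∑' n : ℤ, w.val n ^ 2 * ‖fourierCoeff q.toL2 n‖ ^ 2 := by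
  have h := lp.norm_rpow_eq_tsum (p := 2) (by norm_num) (weightedCoeff w q)
  have h1 : ‖q‖ = ‖weightedCoeff w q‖ := rfl
  simp only [ENNReal.toReal_ofNat, Real.rpow_ofNat] at h
  rw [h1, h]
  refine tsum_congr fun n => ?_
  change ‖(w.val n : ℂ) * fourierCoeff q.toL2 n‖ ^ 2 = _
  simp [mul_pow]

end Hw

/-- The ball `B^o_m = {q : 4 ‖q‖ ≤ m}` among the `L²` potentials of mean value zero. -/
def ballO (m : ℝ) : Set (PerL2 1) := {q | fourierCoeff q 0 = 0 ∧ 4 * ‖q‖ ≤ m}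

/-- The ball `B^w_m = {q ∈ H^w : 4 ‖q‖_w ≤ m}`. -/
def ballW (w : NormalizedWeight) (m : ℝ) : Set (Hw w) := {q | 4 * ‖q‖ ≤ m}

/-! ### Fourier block decomposition -/

instance factTwoPos : Fact ((0 : ℝ) < 2) := ⟨two_pos⟩

/-- The function `e_k(x) = exp(k π i x)` of period 2. -/
noncomputable def e2 (k : ℤ) : PerL2 2 := fourierLp 2 k

/-- `V e_k = q e_k = ∑_j q_j e_{2j+k}`, the product of the potential `q = ∑_j q_j e_{2j}` with
`e_k`. -/
noncomputable def mulE (q : PerL2 1) (k : ℤ) : PerL2 2 :=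
  ∑' j : ℤ, fourierCoeff q j • e2 (2 * j + k)

theorem orthonormal_e2 : Orthonormal ℂ e2 := orthonormal_fourier

theorem summable_sq_fourierCoeff (q : PerL2 1) : Summable fun j : ℤ => ‖fourierCoeff q j‖ ^ 2 := by
  have h := lp.memℓp ((fourierBasis (T := (1 : ℝ))).repr q)
  rw [memℓp_gen_iff (by norm_num)] at h
  refine h.congr fun n => ?_
  rw [fourierBasis_repr]
  simp

theorem orthonormal_e2_shift (k : ℤ) : Orthonormal ℂ fun j : ℤ => e2 (2 * j + k) :=
  orthonormal_e2.comp (fun j : ℤ => 2 * j + k) fun a b h => by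
    simp only at h
    omega

theorem hasSum_mulE (q : PerL2 1) (k : ℤ) :
    HasSum (fun j : ℤ => fourierCoeff q j • e2 (2 * j + k)) (mulE q k) := by
  refine Summable.hasSum ?_
  have h := ((orthonormal_e2_shift k).orthogonalFamily).summable_iff_norm_sq_summable
    (fun j : ℤ => fourierCoeff q j)
  simpa using h.2 (summable_sq_fourierCoeff q)

/-- The product `q e_k` has the norm of `q`. -/
theorem norm_mulE_sq (q : PerL2 1) (k : ℤ) :
    ‖mulE q k‖ ^ 2 = ∑' j : ℤ, ‖fourierCoeff q j‖ ^ 2 := by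
  have h := (((hasSum_mulE q k).mapL (innerSL ℂ (mulE q k))).tsum_eq).symm
  have h2 : ∀ j : ℤ, innerSL ℂ (mulE q k) (fourierCoeff q j • e2 (2 * j + k)) =
      ((‖fourierCoeff q j‖ ^ 2 : ℝ) : ℂ) := by
    intro j
    have h3 := ((hasSum_mulE q k).mapL (innerSL ℂ (e2 (2 * j + k)))).tsum_eq
    have h4 : inner ℂ (e2 (2 * j + k)) (mulE q k) = fourierCoeff q j := by
      rw [innerSL_apply_apply] at h3
      rw [← h3, tsum_eq_single j]
      · simp [orthonormal_e2.1]
      · intro i hij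
        have h5 : inner ℂ (e2 (2 * j + k)) (e2 (2 * i + k)) = 0 :=
          orthonormal_e2.2 (by omega)
        simp [h5]
    rw [innerSL_apply_apply, inner_smul_right, ← inner_conj_symm, h4, Complex.mul_conj,
      Complex.normSq_eq_norm_sq]
  simp only [h2] at h
  rw [innerSL_apply_apply, inner_self_eq_norm_sq_to_K, ← Complex.ofReal_tsum] at h
  exact Complex.ofReal_injective (by push_cast at h ⊢; exact h)

/-- The operator `T_n = V A_z⁻¹ Q_n` on the 2-periodic `L²` functions, that is
`T_n f = ∑_{|k| ≠ n} f_k / (z - k² π²) V e_k`, as a series of rank one operators that converges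
absolutely in the operator norm. -/
noncomputable def opT (n : ℕ) (z : ℂ) (q : PerL2 1) : PerL2 2 →L[ℂ] PerL2 2 :=
  ∑' k : ℤ, if k.natAbs = n then 0 else
    (z - (k : ℂ) ^ 2 * (Real.pi : ℂ) ^ 2)⁻¹ • (innerSL ℂ (e2 k)).smulRight (mulE q k)

theorem summable_opT (n : ℕ) (z : ℂ) (q : PerL2 1) :
    Summable fun k : ℤ => if k.natAbs = n then (0 : PerL2 2 →L[ℂ] PerL2 2) else
      (z - (k : ℂ) ^ 2 * (Real.pi : ℂ) ^ 2)⁻¹ • (innerSL ℂ (e2 k)).smulRight (mulE q k) := by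
  have hs : Summable fun k : ℤ =>
      2 * ‖mulE q 0‖ * (1 / (k : ℝ) ^ 2) :=
    (Real.summable_one_div_int_pow.2 one_lt_two).mul_left _
  refine Summable.of_norm_bounded_eventually hs ?_
  have hfin : {k : ℤ | (k.natAbs : ℝ) ≤ ‖z‖ + 1}.Finite := by
    refine (Set.finite_Icc (-(⌈‖z‖ + 1⌉₊ : ℤ)) ⌈‖z‖ + 1⌉₊).subset fun k hk => ?_
    have : k.natAbs ≤ ⌈‖z‖ + 1⌉₊ := by
      have hk' : (k.natAbs : ℝ) ≤ ‖z‖ + 1 := hk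
      exact_mod_cast hk'.trans (Nat.le_ceil _)
    constructor <;> omega
  filter_upwards [hfin.compl_mem_cofinite] with k hk
  have hk : ‖z‖ + 1 < |(k : ℝ)| := by
    simpa [Nat.cast_natAbs] using hk
  have hq : ‖mulE q k‖ = ‖mulE q 0‖ := by
    have := (norm_mulE_sq q k).trans (norm_mulE_sq q 0).symm
    exact (pow_left_inj₀ (norm_nonneg _) (norm_nonneg _) two_ne_zero).1 this
  split_ifs
  · rw [norm_zero]; positivity
  have hz := norm_nonneg z
  have hk2 : ‖z‖ ≤ (k : ℝ) ^ 2 := by rw [← sq_abs]; nlinarith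
  have hk3 : 0 < (k : ℝ) ^ 2 := by rw [← sq_abs]; nlinarith
  have hd : (k : ℝ) ^ 2 / 2 ≤ ‖z - (k : ℂ) ^ 2 * (Real.pi : ℂ) ^ 2‖ := by
    have h1 := norm_sub_norm_le ((k : ℂ) ^ 2 * (Real.pi : ℂ) ^ 2) z
    have h2 : ‖(k : ℂ) ^ 2 * (Real.pi : ℂ) ^ 2‖ = (k : ℝ) ^ 2 * Real.pi ^ 2 := by
      simp [abs_of_pos Real.pi_pos]
    rw [norm_sub_rev, h2] at h1
    have h3 : 9 ≤ Real.pi ^ 2 := by nlinarith [Real.pi_gt_three]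
    nlinarith [mul_le_mul_of_nonneg_left h3 hk3.le]
  have h1 : ‖(innerSL ℂ (e2 k)).smulRight (mulE q k)‖ = ‖mulE q 0‖ := by
    rw [ContinuousLinearMap.norm_smulRight_apply, innerSL_apply_norm, orthonormal_e2.1, one_mul, hq]
  rw [norm_smul, norm_inv, h1]
  have h2 : ‖z - (k : ℂ) ^ 2 * (Real.pi : ℂ) ^ 2‖⁻¹ ≤ ((k : ℝ) ^ 2 / 2)⁻¹ :=
    inv_anti₀ (by positivity) hd
  calc _ ≤ ((k : ℝ) ^ 2 / 2)⁻¹ * ‖mulE q 0‖ := by gcongr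
    _ = _ := by field_simp

/-- `T_n f = ∑_{|k| ≠ n} f_k / (z - k² π²) V e_k`. -/
theorem hasSum_opT_apply (n : ℕ) (z : ℂ) (q : PerL2 1) (f : PerL2 2) :
    HasSum (fun k : ℤ => if k.natAbs = n then 0 else
      (inner ℂ (e2 k) f / (z - (k : ℂ) ^ 2 * (Real.pi : ℂ) ^ 2)) • mulE q k) (opT n z q f) := by
  have h := (summable_opT n z q).hasSum.mapL (ContinuousLinearMap.apply ℂ (PerL2 2) f)
  change HasSum _ (opT n z q f) at h
  convert h using 1
  funext k
  by_cases hk : k.natAbs = n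
  · simp [hk]
  · simp [hk, smul_smul, div_eq_inv_mul]

/-- `(I - T_n)⁻¹`. -/
noncomputable def opTHat (n : ℕ) (z : ℂ) (q : PerL2 1) : PerL2 2 →L[ℂ] PerL2 2 :=
  Ring.inverse (1 - opT n z q)

/-- `U_n = {z : |Re z - n² π²| ≤ 12 n}`. -/
def stripU (n : ℕ) : Set ℂ := {z | |z.re - (n : ℝ) ^ 2 * Real.pi ^ 2| ≤ 12 * n}

/-- `a_n(z, q) = ⟨(I - T_n)⁻¹ V e_n, e_n⟩`. -/
noncomputable def coeffA (n : ℕ) (z : ℂ) (q : PerL2 1) : ℂ :=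
  inner ℂ (e2 n) (opTHat n z q (mulE q n))

/-- `c_n(z, q) = ⟨(I - T_{|n|})⁻¹ V e_{-n}, e_n⟩`, whose leading term `⟨V e_{-n}, e_n⟩` is the
Fourier coefficient `q_n` of the potential. -/
noncomputable def coeffC (n : ℤ) (z : ℂ) (q : PerL2 1) : ℂ :=
  inner ℂ (e2 n) (opTHat n.natAbs z q (mulE q (-n)))

/-- `z` is a point of `U_n` at which the diagonal `z - n² π² - a_n(z, q)` vanishes. -/
def IsDiagonalZero (n : ℕ) (q : PerL2 1) (z : ℂ) : Prop :=
  z ∈ stripU n ∧ z = (n : ℂ) ^ 2 * (Real.pi : ℂ) ^ 2 + coeffA n z q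

/-- `α_n(q)`, the zero of the diagonal in `U_n`. -/
noncomputable def alphaN (n : ℕ) (q : PerL2 1) : ℂ :=
  Classical.epsilon (IsDiagonalZero n q)

/-! ### The adapted Fourier coefficient map -/

/-- `M_m = 2¹⁰ m²`. -/
def cutoffM (m : ℝ) : ℝ := 2 ^ 10 * m ^ 2

open Classical in
/-- The Fourier coefficients of `Φ_m(q)`. -/
noncomputable def phiCoeff (m : ℝ) (q : PerL2 1) (n : ℤ) : ℂ :=
  if (n.natAbs : ℝ) < cutoffM m then fourierCoeff q n
  else coeffC n (alphaN n.natAbs q) q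

/-- The adapted Fourier coefficient map `Φ_m`. -/
noncomputable def phiMap (m : ℝ) (q : PerL2 1) : PerL2 1 :=
  ∑' n : ℤ, phiCoeff m q n • (fourierLp 2 n : PerL2 1)

open Classical in
/-- `Φ_m` as a map of `H^w` (with the value `0` where `Φ_m(q)` is not in `H^w`). -/
noncomputable def phiMapW (m : ℝ) (w : NormalizedWeight) (q : Hw w) : Hw w :=
  if h : phiMap m q.toL2 ∈ hwSubmodule w then ⟨phiMap m q.toL2, h⟩ else 0

/-- The potential is real-valued. -/
def IsRealPotential (q : PerL2 1) : Prop :=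
  ∀ᵐ x ∂(haarAddCircle (T := (1 : ℝ))), (q x).im = 0

/-- `f` is an analytic diffeomorphism of `s` onto `f(s)`: it is analytic near every point of `s`,
one-to-one on `s`, and its inverse on `f(s)` is analytic near every point of `f(s)`. -/
def IsAnalyticDiffeoOnImage {E : Type*} [NormedAddCommGroup E] [NormedSpace ℂ E]
    (f : E → E) (s : Set E) : Prop :=
  AnalyticOnNhd ℂ f s ∧ Set.InjOn f s ∧
    ∃ g : E → E, AnalyticOnNhd ℂ g (f '' s) ∧ Set.LeftInvOn g f s

/-! The map `Φ_m` is a small analytic perturbation of the identity. For `λ ∈ U_n` the numbers `1/(λ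
- k²π²)`, `|k| ≠ n`, have `ℓ²` norm at most `2/n`, because the strip is narrow compared with the
gaps `π²|k² - n²|`. Cauchy–Schwarz gives `‖T_n‖ ≤ 2‖q‖/n`. Beyond the cutoff the Neumann series
therefore converges, `|a_n| ≤ 2‖q‖`, and the Cauchy estimate makes `λ ↦ n²π² + a_n` a contraction of
a disc that contains every solution. Its fixed point `α_n` is analytic in `q` by the implicit
function theorem.

The weighted bound rests on a shifted norm. With the weight `w((l+N)/2)` on the frequency `l`, the
function `V e_{-N}` has norm `‖q‖_w`, the coefficient at `l = N` carries exactly `w_N`, and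
submultiplicativity gives `T_n` the same bound `2‖q‖_w/n`. Hence `w_N |c_N - q_N| ≤ ‖q‖_w²/|N|`
(`weight_mul_norm_coeffC_sub_le`). The tail of `1/|N|` is square summable with norm at most
`1/(16m)`, so `‖Φ_m(q) - q‖_w ≤ ‖q‖_w²/(16m)`.

All this holds for `‖q‖_w ≤ m/2`, twice the radius of the ball in question. Componentwise
analyticity together with the `ℓ²` majorant makes `Φ_m - I` analytic into `H^w`
(`analyticAt_lp_of_dominated`). Cauchy's estimate on balls of radius `m/4` gives the derivative
bound `1/8`, and a smaller radius gives a bound on a larger open ball, on which `Φ_m` is injective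
and locally invertible.

For reality, transposing the perturbation series shows that `Φ_m` commutes with complex conjugation;
injectivity then gives the equivalence. -/

/-! ### Analytic maps into `ℓ²` -/

section AnalyticLp

variable {E F : Type*} [NormedAddCommGroup E] [NormedSpace ℂ E]
  [NormedAddCommGroup F] [NormedSpace ℂ F]

/-- Cauchy estimates for the iterated Fréchet derivatives. -/
theorem norm_iteratedFDeriv_le_of_analyticOnNhd {f : E → F} {U : Set E} (hU : IsOpen U)
    (hf : AnalyticOnNhd ℂ f U) {C : ℝ} (hC : ∀ y ∈ U, ‖f y‖ ≤ C) {s : ℝ} (hs : 0 < s) (k : ℕ) :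
    ∀ y ∈ U, Metric.ball y (k * s) ⊆ U → ‖iteratedFDeriv ℂ k f y‖ ≤ C * (2 / s) ^ k := by
  induction k with
  | zero => intro y hy _; simpa using hC y hy
  | succ k ih =>
    intro y hy hball
    have hsub : ∀ y' ∈ Metric.ball y s, y' ∈ U ∧ Metric.ball y' (k * s) ⊆ U := by
      intro y' hy'
      refine ⟨hball (Metric.ball_subset_ball ?_ hy'), fun z hz => hball ?_⟩
      · push_cast; nlinarith [mul_nonneg (Nat.cast_nonneg (α := ℝ) k) hs.le]
      · rw [Metric.mem_ball] at *
        push_cast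
        linarith [dist_triangle z y' y]
    have hbd : ∀ y' ∈ Metric.ball y s, ‖iteratedFDeriv ℂ k f y'‖ ≤ C * (2 / s) ^ k :=
      fun y' hy' => ih y' (hsub y' hy').1 (hsub y' hy').2
    have hd : DifferentiableOn ℂ (iteratedFDeriv ℂ k f) (Metric.ball y s) := fun y' hy' =>
      ((hf.iteratedFDeriv_of_isOpen hU k) y' (hsub y' hy').1).differentiableAt.differentiableWithinAt
    rw [← norm_fderiv_iteratedFDeriv]
    -- The Schwarz-type bound requires the image to lie in a ball about the value at the centre. Its
    -- radius is the oscillation, at most twice the sup bound, whence the factor `2/s`.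
    have hm : Set.MapsTo (iteratedFDeriv ℂ k f) (Metric.ball y s)
        (Metric.closedBall (iteratedFDeriv ℂ k f y) (2 * (C * (2 / s) ^ k))) := by
      intro y' hy'
      rw [mem_closedBall_iff_norm]
      have h1 := hbd y' hy'
      have h2 := hbd y (Metric.mem_ball_self hs)
      linarith [norm_sub_le (iteratedFDeriv ℂ k f y') (iteratedFDeriv ℂ k f y)]
    refine (Complex.norm_fderiv_le_div_of_mapsTo_ball hd hm hs).trans_eq ?_
    rw [pow_succ]; ring

/-- The Taylor coefficients of an analytic map bounded on a ball. -/
theorem norm_inv_factorial_smul_iteratedFDeriv_le {f : E → F} {x : E} {R : ℝ} (hR : 0 < R)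
    (hf : AnalyticOnNhd ℂ f (Metric.ball x R)) {C : ℝ}
    (hC : ∀ y ∈ Metric.ball x R, ‖f y‖ ≤ C) (k : ℕ) :
    ‖((k.factorial : ℂ)⁻¹) • iteratedFDeriv ℂ k f x‖ ≤ C * (2 * Real.exp 1 / R) ^ k := by
  have hC0 : 0 ≤ C := (norm_nonneg _).trans (hC x (Metric.mem_ball_self hR))
  rcases Nat.eq_zero_or_pos k with rfl | hk
  · simpa using hC x (Metric.mem_ball_self hR)
  have hk' : (0 : ℝ) < k := by exact_mod_cast hk
  -- Each of the `k` differentiations consumes `R/k` of the radius; the resulting `k^k` is absorbed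
  -- by `k!` at the price of `e^k`.
  have h := norm_iteratedFDeriv_le_of_analyticOnNhd Metric.isOpen_ball hf hC (div_pos hR hk') k x
    (Metric.mem_ball_self hR) (by rw [mul_div_cancel₀ _ hk'.ne'])
  rw [norm_smul, norm_inv, Complex.norm_natCast]
  have hfac : (0 : ℝ) < k.factorial := by exact_mod_cast k.factorial_pos
  have he : (k : ℝ) ^ k / k.factorial ≤ Real.exp 1 ^ k := by
    have := Real.pow_div_factorial_le_exp (k : ℝ) hk'.le k
    rwa [← Real.exp_one_pow] at this
  calc _ ≤ (k.factorial : ℝ)⁻¹ * (C * (2 / (R / k)) ^ k) := by gcongr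
    _ = C * (2 / R) ^ k * ((k : ℝ) ^ k / k.factorial) := by
      rw [div_div_eq_mul_div, mul_div_right_comm, mul_pow]; field_simp
    _ ≤ C * (2 / R) ^ k * Real.exp 1 ^ k := by gcongr
    _ = _ := by rw [mul_assoc, ← mul_pow]; ring_nf

/-- The Taylor series of an analytic map on a ball converges to it on the ball. -/
theorem hasSum_iteratedFDeriv_of_analyticOnNhd_ball [CompleteSpace F] {f : E → F} {x : E} {R : ℝ}
    (hf : AnalyticOnNhd ℂ f (Metric.ball x R)) {h : E} (hh : ‖h‖ < R) :
    HasSum (fun k : ℕ => ((k.factorial : ℂ)⁻¹ • iteratedFDeriv ℂ k f x) fun _ => h) (f (x + h)) := by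
  -- The claim reduces to one variable along the complex line `t ↦ x + t h`. A disc of radius `r >
  -- 1` still maps into the ball and contains `t = 1`.
  obtain ⟨r, hr1, hr⟩ : ∃ r : ℝ, 1 < r ∧ r * ‖h‖ < R := by
    rcases (norm_nonneg h).eq_or_lt with h0 | h0
    · exact ⟨2, one_lt_two, by rw [← h0] at hh ⊢; simpa using hh⟩
    · obtain ⟨r, h1, h2⟩ := exists_between ((one_lt_div h0).2 hh)
      exact ⟨r, h1, (lt_div_iff₀ h0).1 h2⟩
  have hmem : ∀ t ∈ Metric.ball (0 : ℂ) r, x + t • h ∈ Metric.ball x R := by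
    intro t ht
    rw [mem_ball_zero_iff] at ht
    rw [mem_ball_iff_norm, add_sub_cancel_left, norm_smul]
    exact (mul_le_mul_of_nonneg_right ht.le (norm_nonneg _)).trans_lt hr
  have hline : ∀ t : ℂ, HasDerivAt (fun t : ℂ => x + t • h) h t := fun t => by
    simpa using ((hasDerivAt_id t).smul_const h).const_add x
  have hder : ∀ k : ℕ, ∀ t ∈ Metric.ball (0 : ℂ) r,
      iteratedDeriv k (fun t : ℂ => f (x + t • h)) t
        = iteratedFDeriv ℂ k f (x + t • h) fun _ => h := by
    intro k
    induction k with
    | zero => intro t _; simp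
    | succ k ih =>
      intro t ht
      rw [iteratedDeriv_succ, iteratedFDeriv_succ_apply_left]
      have hev : iteratedDeriv k (fun t : ℂ => f (x + t • h)) =ᶠ[nhds t]
          fun t => iteratedFDeriv ℂ k f (x + t • h) fun _ => h :=
        Filter.eventually_of_mem (Metric.isOpen_ball.mem_nhds ht) ih
      rw [hev.deriv_eq]
      have h1 := ((hf.iteratedFDeriv_of_isOpen Metric.isOpen_ball k) _
        (hmem t ht)).differentiableAt.hasFDerivAt.comp_hasDerivAt t (hline t)
      exact ((ContinuousMultilinearMap.apply ℂ (fun _ : Fin k => E) F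
        (fun _ => h)).hasFDerivAt.comp_hasDerivAt t h1).deriv
  have hdiff : DifferentiableOn ℂ (fun t : ℂ => f (x + t • h)) (Metric.ball 0 r) := fun t ht =>
    ((hf _ (hmem t ht)).differentiableAt.comp t
      (hline t).differentiableAt).differentiableWithinAt
  have hs := Complex.hasSum_taylorSeries_on_ball hdiff (z := 1) (by simpa using hr1)
  simp only [one_smul, sub_zero, one_pow] at hs
  convert hs using 2 with k
  rw [hder k 0 (Metric.mem_ball_self (by linarith))]
  simp

theorem lp_norm_le_of_forall_le {ι : Type*} (b x : lp (fun _ : ι => ℂ) 2) {c : ℝ} (hc : 0 ≤ c)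
    (h : ∀ n, ‖x n‖ ≤ c * ‖b n‖) : ‖x‖ ≤ c * ‖b‖ := by
  have h1 : ‖x‖ ≤ ‖(c : ℂ) • b‖ := by
    refine lp.norm_mono (by norm_num) fun n => (h n).trans_eq ?_
    rw [lp.coeFn_smul, Pi.smul_apply, norm_smul, Complex.norm_of_nonneg hc]
  rwa [norm_smul, Complex.norm_of_nonneg hc] at h1

/-- A map into `ℓ²` is analytic if its components are analytic on a ball and dominated there by
a square summable sequence. -/
theorem analyticAt_lp_of_dominated {ι : Type*} {G : E → lp (fun _ : ι => ℂ) 2}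
    (b : lp (fun _ : ι => ℂ) 2) {x : E} {R : ℝ} (hR : 0 < R)
    (hf : ∀ n, AnalyticOnNhd ℂ (fun y => G y n) (Metric.ball x R))
    (hb : ∀ n, ∀ y ∈ Metric.ball x R, ‖G y n‖ ≤ ‖b n‖) : AnalyticAt ℂ G x := by
  set A : ℝ := 2 * Real.exp 1 / R with hA
  have hA0 : 0 < A := by positivity
  -- The Taylor coefficients of the `n`-th component are bounded by `A^k ‖b n‖` with `A` independent
  -- of `n`. They thus assemble into multilinear maps with values in `ℓ²`, which form the power
  -- series of `G`.
  let c : ι → ∀ k : ℕ, E [×k]→L[ℂ] ℂ := fun n k =>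
    ((k.factorial : ℂ)⁻¹) • iteratedFDeriv ℂ k (fun y => G y n) x
  have hc : ∀ n k (v : Fin k → E), ‖c n k v‖ ≤ (A ^ k * ∏ i, ‖v i‖) * ‖b n‖ := by
    intro n k v
    have h1 := (c n k).le_of_opNorm_le
      (norm_inv_factorial_smul_iteratedFDeriv_le hR (hf n) (hb n) k) v
    exact h1.trans_eq (by ring)
  have hmem : ∀ k (v : Fin k → E), Memℓp (fun n => c n k v) 2 := by
    intro k v
    refine ((lp.memℓp b).norm.const_smul (A ^ k * ∏ i, ‖v i‖)).mono fun n => ?_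
    exact hc n k v
  let p : FormalMultilinearSeries ℂ E (lp (fun _ : ι => ℂ) 2) := fun k =>
    MultilinearMap.mkContinuous
      { toFun := fun v => ⟨fun n => c n k v, hmem k v⟩
        map_update_add' := by
          intro _ v i x y
          ext n
          change c n k _ = c n k _ + c n k _
          convert (c n k).map_update_add v i x y
        map_update_smul' := by
          intro _ v i a y
          ext n
          change c n k _ = a • c n k _
          convert (c n k).map_update_smul v i a y } (A ^ k * ‖b‖) (by
      intro v
      refine (lp_norm_le_of_forall_le b _ (c := A ^ k * ∏ i, ‖v i‖) (by positivity)
        fun n => hc n k v).trans_eq (by ring))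
  have hp : ∀ k, ‖p k‖ ≤ A ^ k * ‖b‖ := fun k =>
    MultilinearMap.mkContinuous_norm_le _ (by positivity) _
  have hpa : ∀ k v n, (p k v) n = c n k v := fun _ _ _ => rfl
  -- With this radius the series is dominated by a geometric one of ratio `A r = 1/2`.
  let r : NNReal := ⟨1 / (2 * A), by positivity⟩
  have hr : (r : ℝ) = 1 / (2 * A) := rfl
  have hAr : A * r = 1 / 2 := by rw [hr]; field_simp
  have hrR : (r : ℝ) < R := by
    rw [hr, hA, div_lt_iff₀ (by positivity)]
    have : 1 < Real.exp 1 := Real.one_lt_exp_iff.2 one_pos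
    field_simp
    linarith
  refine ⟨p, r, ?_, by exact_mod_cast (show (0 : ℝ) < r by rw [hr]; positivity), ?_⟩
  · refine p.le_radius_of_bound ‖b‖ fun k => ?_
    calc ‖p k‖ * (r : ℝ) ^ k ≤ A ^ k * ‖b‖ * (r : ℝ) ^ k := by gcongr; exact hp k
      _ = (1 / 2) ^ k * ‖b‖ := by rw [← hAr, mul_pow]; ring
      _ ≤ 1 * ‖b‖ := by gcongr; exact pow_le_one₀ (by norm_num) (by norm_num)
      _ = ‖b‖ := one_mul _
  · intro y hy
    have hy' : ‖y‖ < r := by simpa using hy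
    have hsum : Summable fun k => p k fun _ : Fin k => y := by
      refine Summable.of_norm_bounded (g := fun k => (1 / 2 : ℝ) ^ k * ‖b‖)
        (summable_geometric_two.mul_right _) fun k => ?_
      calc ‖p k fun _ => y‖ ≤ ‖p k‖ * ‖y‖ ^ k := by
            simpa using (p k).le_opNorm fun _ => y
        _ ≤ A ^ k * ‖b‖ * (r : ℝ) ^ k := by gcongr; exact hp k
        _ = (1 / 2) ^ k * ‖b‖ := by rw [← hAr, mul_pow]; ring
    convert hsum.hasSum
    ext n
    have h1 := hasSum_iteratedFDeriv_of_analyticOnNhd_ball (hf n) (hy'.trans hrR)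
    have h2 := hsum.hasSum.mapL (lp.evalCLM ℂ (fun _ : ι => ℂ) 2 n)
    exact h1.unique h2

end AnalyticLp

/-! ### The resolvent coefficients -/

/-- The diagonal entries of `A_z⁻¹ Q_n`. -/
noncomputable def res (n : ℕ) (z : ℂ) (k : ℤ) : ℂ :=
  if k.natAbs = n then 0 else (z - (k : ℂ) ^ 2 * (Real.pi : ℂ) ^ 2)⁻¹

/-- A summable majorant of the resolvent coefficients. -/
noncomputable def resBound (n : ℕ) (k : ℤ) : ℝ :=
  1 / ((k - n : ℤ) : ℝ) ^ 2 + 1 / ((k + n : ℤ) : ℝ) ^ 2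

theorem resBound_nonneg (n : ℕ) (k : ℤ) : 0 ≤ resBound n k := by unfold resBound; positivity

/-- Twice `ζ(2)`; the term `j = 0` contributes nothing, since `1/0 = 0`. -/
theorem hasSum_one_div_int_sq : HasSum (fun j : ℤ => 1 / (j : ℝ) ^ 2) (Real.pi ^ 2 / 3) := by
  have h1 : HasSum (fun j : ℕ => 1 / (((j : ℕ) : ℤ) : ℝ) ^ 2) (Real.pi ^ 2 / 6) := by
    simpa using hasSum_zeta_two
  have h2 : HasSum (fun j : ℕ => 1 / ((-(j : ℤ) : ℤ) : ℝ) ^ 2) (Real.pi ^ 2 / 6) := by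
    simpa using hasSum_zeta_two
  have h := HasSum.of_nat_of_neg (f := fun j : ℤ => 1 / (j : ℝ) ^ 2) h1 h2
  have h0 : Real.pi ^ 2 / 6 + Real.pi ^ 2 / 6 - 1 / ((0 : ℤ) : ℝ) ^ 2 = Real.pi ^ 2 / 3 := by
    norm_num
    ring
  rwa [h0] at h

theorem hasSum_resBound (n : ℕ) : HasSum (resBound n) (Real.pi ^ 2 / 3 + Real.pi ^ 2 / 3) := by
  have h1 := (Equiv.subRight (n : ℤ)).hasSum_iff.2 hasSum_one_div_int_sq
  have h2 := (Equiv.addRight (n : ℤ)).hasSum_iff.2 hasSum_one_div_int_sq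
  exact h1.add h2

theorem sum_resBound_le (n : ℕ) (t : Finset ℤ) : ∑ k ∈ t, resBound n k ≤ 8 := by
  refine (sum_le_hasSum t (fun k _ => resBound_nonneg n k) (hasSum_resBound n)).trans ?_
  nlinarith [Real.pi_lt_d2, Real.pi_pos]

theorem int_sq_eq_natAbs_sq (k : ℤ) : (k : ℝ) ^ 2 = (k.natAbs : ℝ) ^ 2 := by
  rw [Nat.cast_natAbs, Int.cast_abs, sq_abs]

theorem two_mul_sub_one_le_abs_sq_sub_sq {n a : ℕ} (h : a ≠ n) :
    2 * (n : ℝ) - 1 ≤ |(a : ℝ) ^ 2 - n ^ 2| := by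
  rcases lt_or_gt_of_ne h with h | h
  · have h1 : (a : ℝ) + 1 ≤ n := by exact_mod_cast h
    have h0 : (0 : ℝ) ≤ a := a.cast_nonneg
    refine le_trans ?_ (neg_le_abs _)
    nlinarith
  · have h1 : (n : ℝ) + 1 ≤ a := by exact_mod_cast h
    have h0 : (0 : ℝ) ≤ n := n.cast_nonneg
    refine le_trans ?_ (le_abs_self _)
    nlinarith

/-- The real part alone suffices: it is at least `π²|k² - n²| - 12n`. Since `|k² - n²| ≥ 2n - 1` and
`π² ≥ 9.8`, the surplus `7.8(2n - 1)` covers `12n` once `n ≥ 3`. -/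
theorem two_mul_abs_le_norm_sub {n : ℕ} (hn : 3 ≤ n) {z : ℂ} (hz : z ∈ stripU n) {k : ℤ}
    (hk : k.natAbs ≠ n) :
    2 * |(k.natAbs : ℝ) ^ 2 - n ^ 2| ≤ ‖z - (k : ℂ) ^ 2 * (Real.pi : ℂ) ^ 2‖ := by
  have h1 := two_mul_sub_one_le_abs_sq_sub_sq hk
  have h3 : (3 : ℝ) ≤ n := by exact_mod_cast hn
  have hre : (z - (k : ℂ) ^ 2 * (Real.pi : ℂ) ^ 2).re = z.re - (k.natAbs : ℝ) ^ 2 * Real.pi ^ 2 := by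
    rw [← int_sq_eq_natAbs_sq]
    have : ((k : ℂ) ^ 2 * (Real.pi : ℂ) ^ 2) = (((k : ℝ) ^ 2 * Real.pi ^ 2 : ℝ) : ℂ) := by
      push_cast; rfl
    rw [Complex.sub_re, this, Complex.ofReal_re]
  refine le_trans ?_ (Complex.abs_re_le_norm _)
  rw [hre]
  have hz' : |z.re - (n : ℝ) ^ 2 * Real.pi ^ 2| ≤ 12 * n := hz
  have hpi : (9.8 : ℝ) ≤ Real.pi ^ 2 := by nlinarith [Real.pi_gt_d2]
  have h4 : |((k.natAbs : ℝ) ^ 2 - n ^ 2) * Real.pi ^ 2| ≤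
      |z.re - (k.natAbs : ℝ) ^ 2 * Real.pi ^ 2| + |z.re - (n : ℝ) ^ 2 * Real.pi ^ 2| := by
    rw [abs_sub_comm z.re ((k.natAbs : ℝ) ^ 2 * Real.pi ^ 2)]
    refine le_trans (le_of_eq ?_) (abs_add_le _ _)
    congr 1; ring
  rw [abs_mul, abs_of_nonneg (sq_nonneg Real.pi)] at h4
  nlinarith [mul_le_mul_of_nonneg_left hpi (abs_nonneg ((k.natAbs : ℝ) ^ 2 - n ^ 2))]

theorem sub_mul_ne_zero {n : ℕ} (hn : 3 ≤ n) {z : ℂ} (hz : z ∈ stripU n) {k : ℤ}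
    (hk : k.natAbs ≠ n) : z - (k : ℂ) ^ 2 * (Real.pi : ℂ) ^ 2 ≠ 0 := by
  have h1 := two_mul_sub_one_le_abs_sq_sub_sq hk
  have h2 := two_mul_abs_le_norm_sub hn hz hk
  have h3 : (3 : ℝ) ≤ n := by exact_mod_cast hn
  rw [← norm_pos_iff]
  linarith

theorem norm_res_le {n : ℕ} (hn : 3 ≤ n) {z : ℂ} (hz : z ∈ stripU n) (k : ℤ) :
    ‖res n z k‖ ≤ 1 / (2 * n) := by
  have h3 : (3 : ℝ) ≤ n := by exact_mod_cast hn
  unfold res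
  split_ifs with hk
  · rw [norm_zero]; positivity
  rw [norm_inv, ← one_div]
  refine one_div_le_one_div_of_le (by positivity) ?_
  linarith [two_mul_abs_le_norm_sub hn hz hk, two_mul_sub_one_le_abs_sq_sub_sq hk]

theorem one_div_sq_le_resBound {n : ℕ} {k : ℤ} (hk : k.natAbs ≠ n) :
    1 / ((k.natAbs : ℝ) - n) ^ 2 ≤ resBound n k := by
  unfold resBound
  rcases le_total 0 k with h | h
  · obtain ⟨a, rfl⟩ := Int.eq_ofNat_of_zero_le h
    push_cast
    simp only [Int.natAbs_natCast]
    exact le_add_of_nonneg_right (by positivity)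
  · obtain ⟨a, rfl⟩ := Int.exists_eq_neg_ofNat h
    push_cast
    simp only [Int.natAbs_neg, Int.natAbs_natCast]
    rw [show (-(a : ℝ) + n) ^ 2 = (a - n) ^ 2 by ring]
    exact le_add_of_nonneg_left (by positivity)

theorem abs_sq_sub_sq_eq (n a : ℕ) :
    |(a : ℝ) ^ 2 - n ^ 2| = |(a : ℝ) - n| * (a + n) := by
  rw [sq_sub_sq, abs_mul, mul_comm, abs_of_nonneg (by positivity : (0 : ℝ) ≤ (a : ℝ) + n)]

/-- A majorant uniform in `z`, from `|k² - n²| ≥ (|k| - n)²`. It makes the resolvent coefficients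
`ℓ¹`, as the operator norm convergence of the series for `T_n` and the rearrangements of double sums
require. -/
theorem norm_res_le_resBound {n : ℕ} (hn : 3 ≤ n) {z : ℂ} (hz : z ∈ stripU n) (k : ℤ) :
    ‖res n z k‖ ≤ resBound n k := by
  unfold res
  split_ifs with hk
  · rw [norm_zero]; exact resBound_nonneg n k
  refine le_trans ?_ (one_div_sq_le_resBound hk)
  have hpos : 0 < |(k.natAbs : ℝ) - n| := abs_pos.2 (sub_ne_zero.2 (by exact_mod_cast hk))
  rw [norm_inv, ← one_div, ← sq_abs ((k.natAbs : ℝ) - n)]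
  refine one_div_le_one_div_of_le (by positivity) ?_
  refine le_trans ?_ (two_mul_abs_le_norm_sub hn hz hk)
  rw [abs_sq_sub_sq_eq]
  have : |(k.natAbs : ℝ) - n| ≤ k.natAbs + n := by
    simpa using norm_sub_le (k.natAbs : ℝ) (n : ℝ)
  nlinarith

theorem norm_res_sq_le {n : ℕ} (hn : 3 ≤ n) {z : ℂ} (hz : z ∈ stripU n) (k : ℤ) :
    ‖res n z k‖ ^ 2 ≤ 1 / (4 * n ^ 2) * resBound n k := by
  have h3 : (3 : ℝ) ≤ n := by exact_mod_cast hn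
  unfold res
  split_ifs with hk
  · rw [norm_zero, zero_pow two_ne_zero]
    exact mul_nonneg (by positivity) (resBound_nonneg n k)
  have hpos : 0 < |(k.natAbs : ℝ) - n| := abs_pos.2 (sub_ne_zero.2 (by exact_mod_cast hk))
  calc ‖(z - (k : ℂ) ^ 2 * (Real.pi : ℂ) ^ 2)⁻¹‖ ^ 2
      ≤ (1 / (2 * (|(k.natAbs : ℝ) - n| * n))) ^ 2 := by
        rw [norm_inv, ← one_div]
        gcongr
        refine le_trans ?_ (two_mul_abs_le_norm_sub hn hz hk)
        rw [abs_sq_sub_sq_eq]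
        gcongr
        linarith [Nat.cast_nonneg (α := ℝ) k.natAbs]
    _ = 1 / (4 * n ^ 2) * (1 / ((k.natAbs : ℝ) - n) ^ 2) := by
        rw [← sq_abs ((k.natAbs : ℝ) - n)]; field_simp; norm_num
    _ ≤ _ := by gcongr; exact one_div_sq_le_resBound hk

/-- The source of the smallness of `T_n`: here `|k² - n²| ≥ n ||k| - n|` gains the factor `1/n`, and
what remains is a multiple of `ζ(2)`. -/
theorem sum_norm_res_sq_le {n : ℕ} (hn : 3 ≤ n) {z : ℂ} (hz : z ∈ stripU n) (t : Finset ℤ) :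
    ∑ k ∈ t, ‖res n z k‖ ^ 2 ≤ (2 / n) ^ 2 := by
  have h3 : (3 : ℝ) ≤ n := by exact_mod_cast hn
  calc ∑ k ∈ t, ‖res n z k‖ ^ 2 ≤ ∑ k ∈ t, 1 / (4 * (n : ℝ) ^ 2) * resBound n k :=
        Finset.sum_le_sum fun k _ => norm_res_sq_le hn hz k
    _ ≤ 1 / (4 * (n : ℝ) ^ 2) * 8 := by
        rw [← Finset.mul_sum]; gcongr; exact sum_resBound_le n t
    _ ≤ _ := by rw [div_pow]; field_simp; norm_num

/-! ### Bounds for `T_n` -/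

theorem norm_mulE (q : PerL2 1) (k : ℤ) : ‖mulE q k‖ = ‖q‖ := by
  have h1 : ‖q‖ ^ 2 = ∑' j : ℤ, ‖fourierCoeff q j‖ ^ 2 := by
    have h := lp.norm_rpow_eq_tsum (p := 2) (by norm_num) ((fourierBasis (T := (1 : ℝ))).repr q)
    simp only [ENNReal.toReal_ofNat, Real.rpow_ofNat, LinearIsometryEquiv.norm_map,
      fourierBasis_repr] at h
    exact h
  exact (pow_left_inj₀ (norm_nonneg _) (norm_nonneg _) two_ne_zero).1
    ((norm_mulE_sq q k).trans h1.symm)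

theorem hasSum_res_smul_mulE (n : ℕ) (z : ℂ) (q : PerL2 1) (f : PerL2 2) :
    HasSum (fun k : ℤ => (res n z k * inner ℂ (e2 k) f) • mulE q k) (opT n z q f) := by
  convert hasSum_opT_apply n z q f using 2 with k
  unfold res
  split_ifs
  · simp
  · rw [div_eq_inv_mul]

/-- The basic estimate for `T_n`, in a form that covers shifted weighted norms. -/
theorem norm_clm_opT_le {G : Type*} [NormedAddCommGroup G] [NormedSpace ℂ G] {n : ℕ} (hn : 3 ≤ n)
    {z : ℂ} (hz : z ∈ stripU n) (q : PerL2 1) (f : PerL2 2) (P : PerL2 2 →L[ℂ] G) (W : ℤ → ℝ)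
    {C Q : ℝ} (hC : 0 ≤ C) (hQ : 0 ≤ Q) (hP : ∀ k, ‖P (mulE q k)‖ ≤ W k * Q)
    (hf : ∀ t : Finset ℤ, ∑ k ∈ t, W k ^ 2 * ‖inner ℂ (e2 k) f‖ ^ 2 ≤ C ^ 2) :
    ‖P (opT n z q f)‖ ≤ 2 / n * C * Q := by
  have hs := ((hasSum_res_smul_mulE n z q f).mapL P).norm
  refine le_of_tendsto (f := fun t : Finset ℤ => _) hs (Filter.Eventually.of_forall fun t => ?_)
  -- Cauchy–Schwarz between the resolvent coefficients and the weighted coefficients of `f`. No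
  -- boundedness of `V` is used, only the size of each `V e_k`.
  have h1 : ∑ k ∈ t, ‖res n z k‖ * (W k * ‖inner ℂ (e2 k) f‖) ≤ 2 / n * C := by
    refine abs_le_of_sq_le_sq' ?_ (by positivity) |>.2
    refine (Finset.sum_mul_sq_le_sq_mul_sq t _ _).trans ?_
    simp only [mul_pow]
    exact mul_le_mul (sum_norm_res_sq_le hn hz t) (hf t)
      (Finset.sum_nonneg fun _ _ => by positivity) (by positivity)
  refine (norm_sum_le _ _).trans ?_
  calc ∑ k ∈ t, ‖P ((res n z k * inner ℂ (e2 k) f) • mulE q k)‖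
      ≤ ∑ k ∈ t, ‖res n z k‖ * (W k * ‖inner ℂ (e2 k) f‖) * Q := by
        refine Finset.sum_le_sum fun k _ => ?_
        rw [map_smul, norm_smul, norm_mul]
        calc _ ≤ ‖res n z k‖ * ‖inner ℂ (e2 k) f‖ * (W k * Q) := by gcongr; exact hP k
          _ = _ := by ring
    _ ≤ _ := by rw [← Finset.sum_mul]; gcongr

theorem norm_opT_le {n : ℕ} (hn : 3 ≤ n) {z : ℂ} (hz : z ∈ stripU n) (q : PerL2 1) :
    ‖opT n z q‖ ≤ 2 / n * ‖q‖ := by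
  refine ContinuousLinearMap.opNorm_le_bound _ (by positivity) fun f => ?_
  have h := norm_clm_opT_le hn hz q f (ContinuousLinearMap.id ℂ (PerL2 2)) (fun _ => 1)
    (norm_nonneg f) (norm_nonneg q) (fun k => by simp [norm_mulE])
    (fun t => by simpa using orthonormal_e2.sum_inner_products_le f)
  simp only [ContinuousLinearMap.id_apply] at h
  linarith

theorem norm_opT_le_inv {n : ℕ} (hn : 1024 ≤ n) {z : ℂ} (hz : z ∈ stripU n) {q : PerL2 1}
    (hq : 2048 * ‖q‖ ≤ n) : ‖opT n z q‖ ≤ 1 / 1024 := by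
  have h3 : (1024 : ℝ) ≤ n := by exact_mod_cast hn
  refine (norm_opT_le (by omega) hz q).trans ?_
  rw [div_mul_eq_mul_div, div_le_div_iff₀ (by linarith) (by norm_num)]
  linarith

theorem isUnit_one_sub_opT {n : ℕ} (hn : 1024 ≤ n) {z : ℂ} (hz : z ∈ stripU n) {q : PerL2 1}
    (hq : 2048 * ‖q‖ ≤ n) : IsUnit (1 - opT n z q) :=
  isUnit_one_sub_of_norm_lt_one ((norm_opT_le_inv hn hz hq).trans_lt (by norm_num))

/-- `u = (I - T_n)⁻¹ v` solves `u = v + T_n u`. -/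
theorem opTHat_apply_eq {n : ℕ} (hn : 1024 ≤ n) {z : ℂ} (hz : z ∈ stripU n) {q : PerL2 1}
    (hq : 2048 * ‖q‖ ≤ n) (v : PerL2 2) :
    opTHat n z q v = v + opT n z q (opTHat n z q v) := by
  have h := Ring.mul_inverse_cancel _ (isUnit_one_sub_opT hn hz hq)
  have h2 := congrArg (fun L : PerL2 2 →L[ℂ] PerL2 2 => L v) h
  change opTHat n z q v - opT n z q (opTHat n z q v) = v at h2
  exact sub_eq_iff_eq_add.1 h2

theorem norm_opTHat_apply_le {n : ℕ} (hn : 1024 ≤ n) {z : ℂ} (hz : z ∈ stripU n) {q : PerL2 1}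
    (hq : 2048 * ‖q‖ ≤ n) (v : PerL2 2) : ‖opTHat n z q v‖ ≤ 2 * ‖v‖ := by
  have h1 : ‖opTHat n z q v‖ ≤ ‖v‖ + 1 / 1024 * ‖opTHat n z q v‖ := by
    conv_lhs => rw [opTHat_apply_eq hn hz hq v]
    refine (norm_add_le _ _).trans (add_le_add le_rfl ?_)
    exact ContinuousLinearMap.le_of_opNorm_le _ (norm_opT_le_inv hn hz hq) _
  linarith [norm_nonneg v]

theorem norm_inner_e2_le (k : ℤ) (f : PerL2 2) : ‖inner ℂ (e2 k) f‖ ≤ ‖f‖ := by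
  simpa [orthonormal_e2.1] using norm_inner_le_norm (𝕜 := ℂ) (e2 k) f

theorem norm_coeffA_le {n : ℕ} (hn : 1024 ≤ n) {z : ℂ} (hz : z ∈ stripU n) {q : PerL2 1}
    (hq : 2048 * ‖q‖ ≤ n) : ‖coeffA n z q‖ ≤ 2 * ‖q‖ := by
  refine (norm_inner_e2_le _ _).trans ((norm_opTHat_apply_le hn hz hq _).trans_eq ?_)
  rw [norm_mulE]

/-! ### Analyticity of the coefficients and the zero of the diagonal -/

theorem inner_e2_mulE (q : PerL2 1) (k j : ℤ) : inner ℂ (e2 (2 * j + k)) (mulE q k) =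
    fourierCoeff q j := by
  have h := (hasSum_mulE q k).mapL (innerSL ℂ (e2 (2 * j + k)))
  have h' := hasSum_single (f := fun i : ℤ => innerSL ℂ (e2 (2 * j + k))
    (fourierCoeff q i • e2 (2 * i + k))) j (fun i hij => by
      have h5 : inner ℂ (e2 (2 * j + k)) (e2 (2 * i + k)) = 0 := orthonormal_e2.2 (by omega)
      simp [h5])
  have h6 := h.unique h'
  simpa [orthonormal_e2.1] using h6

/-- `q ↦ q e_k` as a continuous linear map. -/
noncomputable def mulECLM (k : ℤ) : PerL2 1 →L[ℂ] PerL2 2 :=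
  LinearMap.mkContinuous
    { toFun := fun q => mulE q k
      map_add' := fun q q' => by
        refine (hasSum_mulE (q + q') k).unique ?_
        simpa only [fourierCoeff_add_Lp, add_smul] using (hasSum_mulE q k).add (hasSum_mulE q' k)
      map_smul' := fun a q => by
        refine (hasSum_mulE (a • q) k).unique ?_
        simp only [fourierCoeff_smul_Lp, mul_smul]
        exact (hasSum_mulE q k).const_smul a }
    1 fun q => by rw [one_mul]; exact (norm_mulE q k).le

/-- `q ↦ ⟨e_k, ·⟩ V e_k` as a continuous linear map. -/
noncomputable def rankOne (k : ℤ) : PerL2 1 →L[ℂ] PerL2 2 →L[ℂ] PerL2 2 :=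
  (ContinuousLinearMap.smulRightL ℂ (PerL2 2) (PerL2 2) (innerSL ℂ (e2 k))).comp (mulECLM k)

theorem rankOne_apply (k : ℤ) (q : PerL2 1) :
    rankOne k q = (innerSL ℂ (e2 k)).smulRight (mulE q k) := rfl

theorem norm_rankOne_le (k : ℤ) : ‖rankOne k‖ ≤ 1 := by
  refine ContinuousLinearMap.opNorm_le_bound _ zero_le_one fun q => ?_
  rw [rankOne_apply, ContinuousLinearMap.norm_smulRight_apply, innerSL_apply_norm,
    orthonormal_e2.1, norm_mulE]

/-- The interior of the strip `U_n`. -/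
def stripInt (n : ℕ) : Set ℂ := {z | |z.re - (n : ℝ) ^ 2 * Real.pi ^ 2| < 12 * n}

theorem isOpen_stripInt (n : ℕ) : IsOpen (stripInt n) :=
  isOpen_lt (by fun_prop) continuous_const

theorem stripInt_subset (n : ℕ) : stripInt n ⊆ stripU n := fun z hz => by
  have : |z.re - (n : ℝ) ^ 2 * Real.pi ^ 2| < 12 * n := hz
  exact this.le

theorem AnalyticAt.clm_apply' {E F G : Type*} [NormedAddCommGroup E] [NormedSpace ℂ E]
    [NormedAddCommGroup F] [NormedSpace ℂ F] [NormedAddCommGroup G] [NormedSpace ℂ G]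
    {L : E → F →L[ℂ] G} {v : E → F} {x : E} (hL : AnalyticAt ℂ L x) (hv : AnalyticAt ℂ v x) :
    AnalyticAt ℂ (fun y => L y (v y)) x :=
  ((ContinuousLinearMap.id ℂ (F →L[ℂ] G)).analyticAt_bilinear (L x, v x)).comp₂ hL hv

/-- Joint analyticity of `T(z, x) = ∑ r_i(z) A_i x`. -/
theorem analyticAt_tsum_smul_clm {ι X B : Type*} [NormedAddCommGroup X] [NormedSpace ℂ X]
    [NormedAddCommGroup B] [NormedSpace ℂ B] [CompleteSpace B] {r : ι → ℂ → ℂ}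
    {A : ι → X →L[ℂ] B} {U : Set ℂ} (hU : IsOpen U) {u : ι → ℝ} (hu : Summable u)
    (hA : ∀ i, ‖A i‖ ≤ 1) (hr : ∀ i, ∀ z ∈ U, ‖r i z‖ ≤ u i)
    (hd : ∀ i, DifferentiableOn ℂ (r i) U) {T : ℂ → X → B}
    (hT : ∀ z x, T z x = ∑' i, r i z • A i x) {z : ℂ} (hz : z ∈ U) (x : X) :
    AnalyticAt ℂ (fun p : ℂ × X => T p.1 p.2) (z, x) := by
  have hle : ∀ i, ∀ w ∈ U, ‖r i w • A i‖ ≤ u i := by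
    intro i w hw
    rw [norm_smul]
    calc _ ≤ u i * 1 := mul_le_mul (hr i w hw) (hA i) (norm_nonneg _)
          ((norm_nonneg _).trans (hr i w hw))
      _ = _ := mul_one _
  -- Since `T` is linear in `x`, joint analyticity follows from that of the operator-valued function
  -- `∑ r_i(z) A_i`, a normally convergent series of holomorphic functions, applied to `x`.
  have hL : AnalyticOnNhd ℂ (fun w => ∑' i, r i w • A i) U := by
    refine DifferentiableOn.analyticOnNhd ?_ hU
    exact Complex.differentiableOn_tsum_of_summable_norm hu (fun i => (hd i).smul_const _) hU hle
  have h1 : AnalyticAt ℂ (fun p : ℂ × X => (∑' i, r i p.1 • A i) p.2) (z, x) :=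
    AnalyticAt.clm_apply' ((hL z hz).comp_of_eq analyticAt_fst rfl) analyticAt_snd
  refine h1.congr ?_
  filter_upwards [continuous_fst.continuousAt.preimage_mem_nhds (hU.mem_nhds hz)] with p hp
  have h2 : HasSum (fun i => r i p.1 • A i) (∑' i, r i p.1 • A i) :=
    (Summable.of_norm_bounded hu fun i => hle i p.1 hp).hasSum
  rw [hT]
  exact (h2.mapL (ContinuousLinearMap.apply ℂ B p.2)).tsum_eq.symm

theorem AnalyticAt.inverse_one_sub {X P : Type*} [NormedAddCommGroup P] [NormedSpace ℂ P]
    [NormedRing X] [NormedAlgebra ℂ X] [CompleteSpace X] {T : P → X} {p : P}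
    (hT : AnalyticAt ℂ T p) (hunit : IsUnit (1 - T p)) :
    AnalyticAt ℂ (fun p => Ring.inverse (1 - T p)) p := by
  obtain ⟨w, hw⟩ := hunit
  exact (analyticAt_inverse (𝕜 := ℂ) w).comp_of_eq (analyticAt_const.sub hT) hw.symm

theorem analyticAt_matrixCoeff_inverse_one_sub {X P : Type*} [NormedAddCommGroup P]
    [NormedSpace ℂ P] [NormedAddCommGroup X] [NormedSpace ℂ X] [CompleteSpace X]
    {T : P → X →L[ℂ] X} {p : P} (hT : AnalyticAt ℂ T p) (hunit : IsUnit (1 - T p))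
    (v : P →L[ℂ] X) (l : X →L[ℂ] ℂ) :
    AnalyticAt ℂ (fun p => l (Ring.inverse (1 - T p) (v p))) p :=
  (l.analyticAt _).comp
    (AnalyticAt.clm_apply' (AnalyticAt.inverse_one_sub hT hunit) (v.analyticAt p))

theorem differentiableOn_res {n : ℕ} (hn : 3 ≤ n) (k : ℤ) :
    DifferentiableOn ℂ (fun z => res n z k) (stripInt n) := by
  by_cases hk : k.natAbs = n
  · simp only [res, hk, if_true]
    exact differentiableOn_const _
  · simp only [res, hk, if_false]
    exact DifferentiableOn.inv (by fun_prop) fun z hz => sub_mul_ne_zero hn (stripInt_subset n hz) hk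

theorem opT_eq_tsum (n : ℕ) (z : ℂ) (q : PerL2 1) :
    opT n z q = ∑' k : ℤ, res n z k • rankOne k q := by
  refine tsum_congr fun k => ?_
  rw [rankOne_apply]
  unfold res
  split_ifs
  · exact (zero_smul _ _).symm
  · rfl

theorem analyticAt_inner_opTHat {n : ℕ} (hn : 1024 ≤ n) {z : ℂ} (hz : z ∈ stripInt n)
    {q : PerL2 1} (hq : 2048 * ‖q‖ ≤ n) (i j : ℤ) :
    AnalyticAt ℂ (fun p : ℂ × PerL2 1 => inner ℂ (e2 i) (opTHat n p.1 p.2 (mulE p.2 j)))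
      (z, q) :=
  analyticAt_matrixCoeff_inverse_one_sub
    (analyticAt_tsum_smul_clm (isOpen_stripInt n) (hasSum_resBound n).summable norm_rankOne_le
      (fun k _ hw => norm_res_le_resBound (by omega) (stripInt_subset n hw) k)
      (differentiableOn_res (by omega)) (opT_eq_tsum n) hz q)
    (isUnit_one_sub_opT hn (stripInt_subset n hz) hq)
    ((mulECLM j).comp (ContinuousLinearMap.snd ℂ ℂ (PerL2 1))) (innerSL ℂ (e2 i))

theorem analyticAt_coeffA {n : ℕ} (hn : 1024 ≤ n) {z : ℂ} (hz : z ∈ stripInt n)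
    {q : PerL2 1} (hq : 2048 * ‖q‖ ≤ n) :
    AnalyticAt ℂ (fun p : ℂ × PerL2 1 => coeffA n p.1 p.2) (z, q) :=
  analyticAt_inner_opTHat hn hz hq n n

/-! ### Localisation, uniqueness and analytic dependence of the zero of the diagonal -/

theorem ball_subset_stripInt {n : ℕ} (hn : 1024 ≤ n) {z : ℂ}
    (hz : ‖z - (n : ℂ) ^ 2 * (Real.pi : ℂ) ^ 2‖ ≤ n) : Metric.ball z n ⊆ stripInt n := by
  intro y hy
  rw [mem_ball_iff_norm] at hy
  have h3 : (1024 : ℝ) ≤ n := by exact_mod_cast hn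
  have h1 := Complex.abs_re_le_norm (y - (n : ℂ) ^ 2 * (Real.pi : ℂ) ^ 2)
  have h2 : (y - (n : ℂ) ^ 2 * (Real.pi : ℂ) ^ 2).re = y.re - (n : ℝ) ^ 2 * Real.pi ^ 2 := by
    have : ((n : ℂ) ^ 2 * (Real.pi : ℂ) ^ 2) = (((n : ℝ) ^ 2 * Real.pi ^ 2 : ℝ) : ℂ) := by
      push_cast; rfl
    rw [Complex.sub_re, this, Complex.ofReal_re]
  rw [h2] at h1
  have h4 := norm_add_le (y - z) (z - (n : ℂ) ^ 2 * (Real.pi : ℂ) ^ 2)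
  rw [sub_add_sub_cancel] at h4
  change |y.re - (n : ℝ) ^ 2 * Real.pi ^ 2| < 12 * n
  linarith

/-- Cauchy's estimate on a disc of radius `n`, which stays within distance `2n` of `n²π²` and so
inside the strip. There `a_n` oscillates by at most `4‖q‖`, far less than `n/2`. -/
theorem norm_deriv_coeffA_le {n : ℕ} (hn : 1024 ≤ n) {q : PerL2 1} (hq : 2048 * ‖q‖ ≤ n) {z : ℂ}
    (hz : ‖z - (n : ℂ) ^ 2 * (Real.pi : ℂ) ^ 2‖ ≤ n) :
    DifferentiableAt ℂ (fun z => coeffA n z q) z ∧ ‖deriv (fun z => coeffA n z q) z‖ ≤ 1 / 2 := by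
  have h3 : (1024 : ℝ) ≤ n := by exact_mod_cast hn
  have hsub := ball_subset_stripInt hn hz
  have hd : ∀ y ∈ Metric.ball z n, DifferentiableAt ℂ (fun z => coeffA n z q) y := fun y hy =>
    ((analyticAt_coeffA hn (hsub hy) hq).comp_of_eq
      (analyticAt_id.prod analyticAt_const) rfl).differentiableAt
  refine ⟨hd z (Metric.mem_ball_self (by linarith)), ?_⟩
  have hm : Set.MapsTo (fun z => coeffA n z q) (Metric.ball z n)
      (Metric.closedBall (coeffA n z q) (n / 2)) := by
    intro y hy
    rw [mem_closedBall_iff_norm]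
    have h1 := norm_coeffA_le hn (stripInt_subset n (hsub hy)) hq
    have h2 := norm_coeffA_le hn
      (stripInt_subset n (hsub (Metric.mem_ball_self (x := z) (by linarith)))) hq
    linarith [norm_sub_le (coeffA n y q) (coeffA n z q)]
  have h := Complex.norm_deriv_le_div_of_mapsTo_ball
    (fun y hy => (hd y hy).differentiableWithinAt) hm (by linarith)
  refine h.trans_eq ?_
  field_simp

theorem norm_sub_le_of_isDiagonalZero {n : ℕ} (hn : 1024 ≤ n) {q : PerL2 1}
    (hq : 2048 * ‖q‖ ≤ n) {z : ℂ} (hz : IsDiagonalZero n q z) :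
    ‖z - (n : ℂ) ^ 2 * (Real.pi : ℂ) ^ 2‖ ≤ n := by
  have h1 := norm_coeffA_le hn hz.1 hq
  rw [sub_eq_iff_eq_add'.2 hz.2]
  linarith [norm_nonneg q]

/-- Banach's fixed point theorem on the closed disc of radius `n` about `n²π²`. Uniqueness extends
to the whole unbounded strip because `|a_n| ≤ 2‖q‖ ≤ n` forces every zero into this disc. -/
theorem existsUnique_isDiagonalZero {n : ℕ} (hn : 1024 ≤ n) {q : PerL2 1}
    (hq : 2048 * ‖q‖ ≤ n) : ∃! z : ℂ, IsDiagonalZero n q z := by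
  have h3 : (1024 : ℝ) ≤ n := by exact_mod_cast hn
  set c : ℂ := (n : ℂ) ^ 2 * (Real.pi : ℂ) ^ 2 with hc
  set s : Set ℂ := Metric.closedBall c n with hs
  have hmem : ∀ z, z ∈ s ↔ ‖z - c‖ ≤ n := fun z => mem_closedBall_iff_norm
  have hstrip : ∀ z ∈ s, z ∈ stripU n := fun z hz => stripInt_subset n
    (ball_subset_stripInt hn ((hmem z).1 hz) (Metric.mem_ball_self (by linarith)))
  have hlip : ∀ x ∈ s, ∀ y ∈ s, ‖coeffA n y q - coeffA n x q‖ ≤ 1 / 2 * ‖y - x‖ := fun x hx y hy =>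
    (convex_closedBall c (n : ℝ)).norm_image_sub_le_of_norm_deriv_le
      (f := fun z => coeffA n z q)
      (fun z hz => (norm_deriv_coeffA_le hn hq ((hmem z).1 hz)).1)
      (fun z hz => (norm_deriv_coeffA_le hn hq ((hmem z).1 hz)).2) hx hy
  have hmaps : Set.MapsTo (fun z => c + coeffA n z q) s s := by
    intro z hz
    rw [hmem, add_sub_cancel_left]
    linarith [norm_coeffA_le hn (hstrip z hz) hq, norm_nonneg q]
  have hcontr : ContractingWith (1 / 2) (hmaps.restrict _ s s) := by
    refine ⟨by norm_num, LipschitzWith.of_dist_le_mul fun x y => ?_⟩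
    rw [Subtype.dist_eq, Subtype.dist_eq, dist_eq_norm, dist_eq_norm]
    simp only [Set.MapsTo.val_restrict_apply, add_sub_add_left_eq_sub]
    simpa using hlip y y.2 x x.2
  obtain ⟨z, hz, hfix, -⟩ := hcontr.exists_fixedPoint' (Metric.isClosed_closedBall.isComplete)
    hmaps (x := c) (Metric.mem_closedBall_self (by linarith)) (edist_ne_top _ _)
  refine ⟨z, ⟨hstrip z hz, hfix.symm⟩, fun y hy => ?_⟩
  have h1 := hlip z hz y ((hmem y).2 (norm_sub_le_of_isDiagonalZero hn hq hy))
  have h2 : coeffA n y q - coeffA n z q = y - z := by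
    have hz2 : c + coeffA n z q = z := hfix
    have hy2 : y = c + coeffA n y q := hy.2
    linear_combination -hz2 - hy2
  rw [h2] at h1
  have : ‖y - z‖ = 0 := by linarith [norm_nonneg (y - z)]
  exact sub_eq_zero.1 (norm_eq_zero.1 this)

theorem isDiagonalZero_alphaN {n : ℕ} (hn : 1024 ≤ n) {q : PerL2 1} (hq : 2048 * ‖q‖ ≤ n) :
    IsDiagonalZero n q (alphaN n q) :=
  Classical.epsilon_spec (existsUnique_isDiagonalZero hn hq).exists

theorem alphaN_mem_stripInt {n : ℕ} (hn : 1024 ≤ n) {q : PerL2 1} (hq : 2048 * ‖q‖ ≤ n) :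
    alphaN n q ∈ stripInt n :=
  ball_subset_stripInt hn (norm_sub_le_of_isDiagonalZero hn hq (isDiagonalZero_alphaN hn hq))
    (Metric.mem_ball_self (by have : (1024 : ℝ) ≤ n := by exact_mod_cast hn
                              linarith))

/-- An isolated zero depends analytically on the parameter. -/
theorem analyticAt_of_unique_zero {X : Type*} [NormedAddCommGroup X] [NormedSpace ℂ X]
    [CompleteSpace X] {f : X × ℂ → ℂ} {α : X → ℂ} {x₀ : X} (hf : AnalyticAt ℂ f (x₀, α x₀))
    {d : ℂ} (hd : HasDerivAt (fun z => f (x₀, z)) d (α x₀)) (hne : d ≠ 0) {U : Set ℂ}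
    (hU : U ∈ nhds (α x₀)) (h0 : f (x₀, α x₀) = 0)
    (huniq : ∀ᶠ x in nhds x₀, ∀ z ∈ U, f (x, z) = 0 → z = α x) : AnalyticAt ℂ α x₀ := by
  have cdf : ContDiffAt ℂ ⊤ f (x₀, α x₀) := hf.contDiffAt
  have hinr : fderiv ℂ f (x₀, α x₀) ∘L .inr ℂ X ℂ =
      ContinuousLinearMap.toSpanSingleton ℂ d := by
    have h1 : HasFDerivAt (fun z : ℂ => f (x₀, z)) (fderiv ℂ f (x₀, α x₀) ∘L .inr ℂ X ℂ)
        (α x₀) :=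
      HasFDerivAt.comp (g := f) (α x₀) hf.differentiableAt.hasFDerivAt
        (hasFDerivAt_prodMk_right x₀ (α x₀))
    exact h1.unique hd.hasFDerivAt
  have if₂ : (fderiv ℂ f (x₀, α x₀) ∘L .inr ℂ X ℂ).IsInvertible := by
    refine ⟨ContinuousLinearEquiv.unitsEquivAut ℂ (Units.mk0 _ hne), ?_⟩
    rw [hinr]
    ext
    simp
  set ψ := cdf.implicitFunction (by simp) if₂ with hψ
  have hψa : AnalyticAt ℂ ψ x₀ := (cdf.contDiffAt_implicitFunction (by simp) if₂).analyticAt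
  have hψq : ψ x₀ = α x₀ := cdf.implicitFunction_apply_self (by simp) if₂
  -- No continuity of `α` is assumed: the implicit function is continuous, hence stays in `U`, where
  -- it is the only zero and must equal `α`.
  refine hψa.congr ?_
  have h1 : ∀ᶠ x in nhds x₀, f (x, ψ x) = f (x₀, α x₀) :=
    cdf.eventually_apply_implicitFunction (by simp) if₂
  have h2 : ∀ᶠ x in nhds x₀, ψ x ∈ U := hψa.continuousAt.eventually_mem (by rwa [hψq])
  filter_upwards [h1, h2, huniq] with x hx1 hx2 hx3
  exact hx3 _ hx2 (hx1.trans h0)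

theorem analyticAt_alphaN {n : ℕ} (hn : 1024 ≤ n) {q : PerL2 1} (hq : 2048 * ‖q‖ < n) :
    AnalyticAt ℂ (alphaN n) q := by
  set c : ℂ := (n : ℂ) ^ 2 * (Real.pi : ℂ) ^ 2 with hc
  have hα := isDiagonalZero_alphaN hn hq.le
  have hmem := alphaN_mem_stripInt hn hq.le
  have hder := norm_deriv_coeffA_le hn hq.le (norm_sub_le_of_isDiagonalZero hn hq.le hα)
  have hA : AnalyticAt ℂ (fun p : PerL2 1 × ℂ => coeffA n p.2 p.1) (q, alphaN n q) :=
    AnalyticAt.comp (g := fun p : ℂ × PerL2 1 => coeffA n p.1 p.2)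
      (f := fun p : PerL2 1 × ℂ => (p.2, p.1)) (analyticAt_coeffA hn hmem hq.le)
      (analyticAt_snd.prod analyticAt_fst)
  refine analyticAt_of_unique_zero (f := fun p : PerL2 1 × ℂ => p.2 - c - coeffA n p.2 p.1)
    (d := 1 - deriv (fun z => coeffA n z q) (alphaN n q))
    ((analyticAt_snd.sub analyticAt_const).sub hA)
    (((hasDerivAt_id _).sub_const c).sub hder.1.hasDerivAt) ?_
    ((isOpen_stripInt n).mem_nhds hmem) ?_ ?_
  -- The derivative of `a_n` has norm at most `1/2`, so it cannot be `1`.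
  · intro h0
    have h1 := hder.2
    rw [← sub_eq_zero.1 h0] at h1
    norm_num at h1
  · have := hα.2
    linear_combination this
  · have h3 : ∀ᶠ x : PerL2 1 in nhds q, 2048 * ‖x‖ < n :=
      (isOpen_lt (continuous_const.mul continuous_norm) continuous_const).mem_nhds hq
    filter_upwards [h3] with x hx z hz hz0
    refine (existsUnique_isDiagonalZero hn hx.le).unique ⟨stripInt_subset n hz, ?_⟩
      (isDiagonalZero_alphaN hn hx.le)
    linear_combination hz0

theorem analyticAt_coeffC_alphaN {n : ℤ} (hn : 1024 ≤ n.natAbs) {q : PerL2 1}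
    (hq : 2048 * ‖q‖ < n.natAbs) :
    AnalyticAt ℂ (fun q => coeffC n (alphaN n.natAbs q) q) q :=
  AnalyticAt.comp (g := fun p : ℂ × PerL2 1 => coeffC n p.1 p.2)
    (f := fun q => (alphaN n.natAbs q, q))
    (analyticAt_inner_opTHat hn (alphaN_mem_stripInt hn hq.le) hq.le n (-n))
    ((analyticAt_alphaN hn hq).prod analyticAt_id)

/-! ### Weighted estimates -/

/-- The coefficients of `q` with respect to `e_l`, `l ∈ ℤ`. -/
noncomputable def evenCoeff (q : PerL2 1) (l : ℤ) : ℂ :=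
  if Even l then fourierCoeff q (l / 2) else 0

theorem inner_e2_mulE_eq_evenCoeff (q : PerL2 1) (k l : ℤ) :
    inner ℂ (e2 l) (mulE q k) = evenCoeff q (l - k) := by
  unfold evenCoeff
  split_ifs with h
  · obtain ⟨j, hj⟩ := h
    rw [show (l - k) / 2 = j by omega, ← inner_e2_mulE q k j, show 2 * j + k = l by omega]
  · have h' := (hasSum_mulE q k).mapL (innerSL ℂ (e2 l))
    refine h'.unique ?_
    have h0 : ∀ j : ℤ, innerSL ℂ (e2 l) (fourierCoeff q j • e2 (2 * j + k)) = 0 := fun j => by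
      have h5 : inner ℂ (e2 l) (e2 (2 * j + k)) = 0 := orthonormal_e2.2 fun h6 => h ⟨j, by omega⟩
      simp [h5]
    simp only [h0]
    exact hasSum_zero

/-- `Q` dominates the `w`-norm of `q`. -/
def WeightedNormLE (w : NormalizedWeight) (q : PerL2 1) (Q : ℝ) : Prop :=
  ∀ t : Finset ℤ, ∑ j ∈ t, w.val j ^ 2 * ‖fourierCoeff q j‖ ^ 2 ≤ Q ^ 2

theorem sum_evenCoeff_le {w : NormalizedWeight} {q : PerL2 1} {Q : ℝ}
    (hQ : WeightedNormLE w q Q) (t : Finset ℤ) :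
    ∑ l ∈ t, w.val (l / 2) ^ 2 * ‖evenCoeff q l‖ ^ 2 ≤ Q ^ 2 := by
  classical
  calc ∑ l ∈ t, w.val (l / 2) ^ 2 * ‖evenCoeff q l‖ ^ 2
      = ∑ l ∈ t.filter Even, w.val (l / 2) ^ 2 * ‖fourierCoeff q (l / 2)‖ ^ 2 := by
        rw [Finset.sum_filter]
        refine Finset.sum_congr rfl fun l _ => ?_
        unfold evenCoeff
        split_ifs <;> simp
    _ = ∑ j ∈ (t.filter Even).image (fun l => l / 2), w.val j ^ 2 * ‖fourierCoeff q j‖ ^ 2 := by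
        rw [Finset.sum_image]
        intro a ha b hb hab
        obtain ⟨c, hc⟩ := (Finset.mem_filter.1 ha).2
        obtain ⟨d, hd⟩ := (Finset.mem_filter.1 hb).2
        have : a / 2 = b / 2 := hab
        omega
    _ ≤ Q ^ 2 := hQ _

theorem sum_evenCoeff_shift_le {w : NormalizedWeight} {q : PerL2 1} {Q : ℝ}
    (hQ : WeightedNormLE w q Q) (e : ℤ ≃ ℤ) (t : Finset ℤ) :
    ∑ l ∈ t, w.val (e l / 2) ^ 2 * ‖evenCoeff q (e l)‖ ^ 2 ≤ Q ^ 2 := by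
  have := sum_evenCoeff_le hQ (t.map e.toEmbedding)
  rwa [Finset.sum_map] at this

/-- `C` dominates the norm of `f` weighted by `W`. -/
def FourierBound (W : ℤ → ℝ) (f : PerL2 2) (C : ℝ) : Prop :=
  ∀ t : Finset ℤ, ∑ k ∈ t, W k ^ 2 * ‖inner ℂ (e2 k) f‖ ^ 2 ≤ C ^ 2

/-- The coefficients in `t`, weighted by `W`. -/
noncomputable def weightedProj (W : ℤ → ℝ) (t : Finset ℤ) : PerL2 2 →L[ℂ] EuclideanSpace ℂ t :=
  ((EuclideanSpace.equiv t ℂ).symm : (t → ℂ) →L[ℂ] EuclideanSpace ℂ t).comp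
    (ContinuousLinearMap.pi fun k : t => (W k : ℂ) • innerSL ℂ (e2 k))

theorem norm_weightedProj_sq (W : ℤ → ℝ) (t : Finset ℤ) (f : PerL2 2) :
    ‖weightedProj W t f‖ ^ 2 = ∑ k ∈ t, W k ^ 2 * ‖inner ℂ (e2 k) f‖ ^ 2 := by
  rw [EuclideanSpace.norm_sq_eq, ← Finset.sum_coe_sort t]
  refine Finset.sum_congr rfl fun k _ => ?_
  change ‖(W k : ℂ) * inner ℂ (e2 k) f‖ ^ 2 = _
  rw [norm_mul, mul_pow, Complex.norm_real, Real.norm_eq_abs, sq_abs]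

theorem fourierBound_iff {W : ℤ → ℝ} {f : PerL2 2} {C : ℝ} (hC : 0 ≤ C) :
    FourierBound W f C ↔ ∀ t, ‖weightedProj W t f‖ ≤ C := by
  refine forall_congr' fun t => ?_
  rw [← norm_weightedProj_sq, sq_le_sq₀ (norm_nonneg _) hC]

theorem FourierBound.add {W : ℤ → ℝ} {f g : PerL2 2} {C D : ℝ} (hC : 0 ≤ C) (hD : 0 ≤ D)
    (hf : FourierBound W f C) (hg : FourierBound W g D) : FourierBound W (f + g) (C + D) := by
  rw [fourierBound_iff] at * <;> try positivity
  intro t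
  rw [map_add]
  exact (norm_add_le _ _).trans (add_le_add (hf t) (hg t))

theorem FourierBound.mono {W : ℤ → ℝ} {f : PerL2 2} {C D : ℝ} (hC : 0 ≤ C) (hCD : C ≤ D)
    (hf : FourierBound W f C) : FourierBound W f D := fun t =>
  (hf t).trans (by gcongr)

theorem FourierBound.of_tendsto {W : ℤ → ℝ} {f : ℕ → PerL2 2} {g : PerL2 2} {C : ℝ} (hC : 0 ≤ C)
    (hf : ∀ i, FourierBound W (f i) C) (h : Filter.Tendsto f Filter.atTop (nhds g)) :
    FourierBound W g C := by
  rw [fourierBound_iff hC]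
  intro t
  have h1 := (((weightedProj W t).continuous.tendsto g).comp h).norm
  exact le_of_tendsto h1 (Filter.Eventually.of_forall fun i => (fourierBound_iff hC).1 (hf i) t)

/-- Division by 2 rounds down; adding an even number does not change the rounding. Odd differences
never matter, as `q` has only even frequencies. -/
theorem submultiplicative_half {w : NormalizedWeight} (hw : w.Submultiplicative) {a b c : ℤ}
    (h : a = b + c) (hc : Even c) : w.val (a / 2) ≤ w.val (b / 2) * w.val (c / 2) := by
  obtain ⟨d, rfl⟩ := hc
  rw [show a / 2 = b / 2 + (d + d) / 2 by omega]
  exact hw _ _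

theorem NormalizedWeight.nonneg (w : NormalizedWeight) (n : ℤ) : 0 ≤ w.val n :=
  zero_le_one.trans (w.one_le n)

/-- The matrix of `V` depends only on `l - k`, and submultiplicativity splits the weight along `l +
N = (k + N) + (l - k)`. -/
theorem fourierBound_mulE {w : NormalizedWeight} (hw : w.Submultiplicative) {q : PerL2 1} {Q : ℝ}
    (hQ : WeightedNormLE w q Q) (N k : ℤ) :
    FourierBound (fun l => w.val ((l + N) / 2)) (mulE q k) (w.val ((k + N) / 2) * Q) := by
  intro t
  calc ∑ l ∈ t, w.val ((l + N) / 2) ^ 2 * ‖inner ℂ (e2 l) (mulE q k)‖ ^ 2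
      ≤ ∑ l ∈ t, w.val ((k + N) / 2) ^ 2 *
          (w.val ((l - k) / 2) ^ 2 * ‖evenCoeff q (l - k)‖ ^ 2) := by
        refine Finset.sum_le_sum fun l _ => ?_
        rw [inner_e2_mulE_eq_evenCoeff, ← mul_assoc, ← mul_pow (w.val ((k + N) / 2))]
        by_cases h : Even (l - k)
        · refine mul_le_mul_of_nonneg_right (pow_le_pow_left₀ (w.nonneg _) ?_ 2) (by positivity)
          exact submultiplicative_half hw (by ring) h
        · simp [evenCoeff, h]
    _ ≤ (w.val ((k + N) / 2) * Q) ^ 2 := by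
        rw [← Finset.mul_sum, mul_pow]
        gcongr
        exact sum_evenCoeff_shift_le hQ (Equiv.subRight k) t

/-- The shift by `N` is chosen for this vector: the weight sits exactly on the coefficients of `q`,
and no factor is lost. -/
theorem fourierBound_mulE_neg {w : NormalizedWeight} {q : PerL2 1} {Q : ℝ}
    (hQ : WeightedNormLE w q Q) (N : ℤ) :
    FourierBound (fun l => w.val ((l + N) / 2)) (mulE q (-N)) Q := by
  intro t
  refine le_trans (le_of_eq ?_) (sum_evenCoeff_shift_le hQ (Equiv.addRight N) t)
  refine Finset.sum_congr rfl fun l _ => ?_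
  rw [inner_e2_mulE_eq_evenCoeff, sub_neg_eq_add]
  rfl

/-- The basic estimate applied to the finite weighted projections: the constant is that of the
unweighted case, independent of `N` and of the weight. -/
theorem fourierBound_opT {w : NormalizedWeight} (hw : w.Submultiplicative) {q : PerL2 1} {Q : ℝ}
    (hQ0 : 0 ≤ Q) (hQ : WeightedNormLE w q Q) {n : ℕ} (hn : 3 ≤ n) {z : ℂ} (hz : z ∈ stripU n)
    (N : ℤ) {f : PerL2 2} {C : ℝ} (hC : 0 ≤ C)
    (hf : FourierBound (fun l => w.val ((l + N) / 2)) f C) :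
    FourierBound (fun l => w.val ((l + N) / 2)) (opT n z q f) (2 / n * C * Q) := by
  rw [fourierBound_iff (by positivity)]
  intro t
  exact norm_clm_opT_le hn hz q f _ (fun l => w.val ((l + N) / 2)) hC hQ0
    (fun k => (fourierBound_iff (mul_nonneg (w.nonneg _) hQ0)).1
      (fourierBound_mulE hw hQ N k) t) hf

/-- The Neumann series. -/
theorem tendsto_iterate_of_norm_lt_one {Y : Type*} [NormedAddCommGroup Y] [NormedSpace ℂ Y]
    {T : Y →L[ℂ] Y} (hT : ‖T‖ ≤ 1 / 2) {u v : Y} (hu : u = v + T u) :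
    Filter.Tendsto (fun i => (fun f => v + T f)^[i] 0) Filter.atTop (nhds u) := by
  rw [tendsto_iff_norm_sub_tendsto_zero]
  have hb : ∀ i : ℕ, ‖(fun f => v + T f)^[i] 0 - u‖ ≤ (1 / 2 : ℝ) ^ i * ‖u‖ := by
    intro i
    induction i with
    | zero => simp
    | succ i ih =>
      rw [Function.iterate_succ_apply']
      have h1 : v + T ((fun f => v + T f)^[i] 0) - u = T ((fun f => v + T f)^[i] 0 - u) := by
        rw [map_sub]
        have h2 : T u = u - v := eq_sub_of_add_eq' hu.symm
        rw [h2]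
        abel
      rw [h1]
      refine (T.le_of_opNorm_le hT _).trans ?_
      rw [pow_succ]
      linarith
  refine squeeze_zero (fun _ => norm_nonneg _) hb ?_
  simpa using (tendsto_pow_atTop_nhds_zero_of_lt_one (r := (1 / 2 : ℝ)) (by norm_num)
    (by norm_num)).mul_const ‖u‖

/-- The Neumann iterates converge in `L²` and all keep the bound `2Q`, because `Q + (2/n)(2Q)Q ≤
2Q`. Bounds on finite sums of coefficients survive `L²` limits, so no inversion in a weighted space
is needed. -/
theorem fourierBound_opTHat {w : NormalizedWeight} (hw : w.Submultiplicative) {q : PerL2 1} {Q : ℝ}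
    (hQ0 : 0 ≤ Q) (hQ : WeightedNormLE w q Q) {n : ℕ} (hn : 1024 ≤ n) {z : ℂ} (hz : z ∈ stripU n)
    (hq : 2048 * ‖q‖ ≤ n) (hQn : 2048 * Q ≤ n) (N : ℤ) :
    FourierBound (fun l => w.val ((l + N) / 2)) (opTHat n z q (mulE q (-N))) (2 * Q) := by
  have h3 : (1024 : ℝ) ≤ n := by exact_mod_cast hn
  have hT : ‖opT n z q‖ ≤ 1 / 2 := (norm_opT_le_inv hn hz hq).trans (by norm_num)
  refine FourierBound.of_tendsto (by positivity) (fun i => ?_)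
    (tendsto_iterate_of_norm_lt_one hT (opTHat_apply_eq hn hz hq (mulE q (-N))))
  induction i with
  | zero =>
    intro t
    simp only [Function.iterate_zero, id_eq, inner_zero_right, norm_zero]
    simpa using by positivity
  | succ i ih =>
    rw [Function.iterate_succ_apply']
    have hb : 2 / n * (2 * Q) * Q ≤ Q := by
      rw [div_mul_eq_mul_div, div_mul_eq_mul_div, div_le_iff₀ (by linarith)]
      nlinarith
    refine FourierBound.mono (C := Q + 2 / n * (2 * Q) * Q) (by positivity) (by linarith) ?_
    exact (fourierBound_mulE_neg hQ N).add hQ0 (by positivity)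
      (fourierBound_opT hw hQ0 hQ (by omega) hz N (by positivity) ih)

theorem inner_e2_mulE_neg_self (q : PerL2 1) (N : ℤ) :
    inner ℂ (e2 N) (mulE q (-N)) = fourierCoeff q N := by
  rw [inner_e2_mulE_eq_evenCoeff, evenCoeff, if_pos ⟨N, by ring⟩]
  congr 1
  omega

/-- The main estimate: `w_n |c_n - q_n| ≤ ‖q‖_w² / |n|`. -/
theorem weight_mul_norm_coeffC_sub_le {w : NormalizedWeight} (hw : w.Submultiplicative)
    {q : PerL2 1} {Q : ℝ} (hQ0 : 0 ≤ Q) (hQ : WeightedNormLE w q Q) {N : ℤ}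
    (hn : 1024 ≤ N.natAbs) {z : ℂ} (hz : z ∈ stripU N.natAbs) (hq : 2048 * ‖q‖ ≤ N.natAbs)
    (hQn : 2048 * Q ≤ N.natAbs) :
    w.val N * ‖coeffC N z q - fourierCoeff q N‖ ≤ Q ^ 2 / N.natAbs := by
  set n := N.natAbs with hn'
  have h3 : (1024 : ℝ) ≤ n := by exact_mod_cast hn
  set u := opTHat n z q (mulE q (-N)) with hu
  -- From `u = V e_{-N} + T_n u`: the first term contributes `q_N` and the error is the coefficient
  -- of `T_n u` at `N`.
  have h1 : coeffC N z q - fourierCoeff q N = inner ℂ (e2 N) (opT n z q u) := by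
    change inner ℂ (e2 N) u - _ = _
    nth_rewrite 1 [hu, opTHat_apply_eq hn hz hq]
    rw [inner_add_right, inner_e2_mulE_neg_self, add_sub_cancel_left]
  have hfu := fourierBound_opTHat hw hQ0 hQ hn hz hq hQn N
  rw [h1]
  have hs := (((hasSum_res_smul_mulE n z q u).mapL (innerSL ℂ (e2 N))).norm).const_mul (w.val N)
  rw [innerSL_apply_apply] at hs
  refine le_of_tendsto (f := fun t : Finset ℤ => _) hs (Filter.Eventually.of_forall fun t => ?_)
  -- The weight `w_N` is split between `u`, of shifted norm at most `2Q`, and `q`. The uniform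
  -- resolvent bound `1/(2n)` then yields `Q²/n`.
  have hcs : ∑ k ∈ t, (w.val ((k + N) / 2) * ‖inner ℂ (e2 k) u‖) *
      (w.val ((N - k) / 2) * ‖evenCoeff q (N - k)‖) ≤ 2 * Q * Q := by
    refine abs_le_of_sq_le_sq' ?_ (by positivity) |>.2
    refine (Finset.sum_mul_sq_le_sq_mul_sq t _ _).trans ?_
    simp only [mul_pow]
    have e1 := hfu t
    have e2 := sum_evenCoeff_shift_le hQ (Equiv.subLeft N) t
    rw [mul_pow] at e1
    exact mul_le_mul e1 e2 (Finset.sum_nonneg fun _ _ => by positivity) (by positivity)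
  calc w.val N * ‖∑ k ∈ t, innerSL ℂ (e2 N) ((res n z k * inner ℂ (e2 k) u) • mulE q k)‖
      ≤ w.val N * ∑ k ∈ t, ‖innerSL ℂ (e2 N) ((res n z k * inner ℂ (e2 k) u) • mulE q k)‖ :=
        mul_le_mul_of_nonneg_left (norm_sum_le _ _) (w.nonneg _)
    _ ≤ ∑ k ∈ t, 1 / (2 * n) * ((w.val ((k + N) / 2) * ‖inner ℂ (e2 k) u‖) *
          (w.val ((N - k) / 2) * ‖evenCoeff q (N - k)‖)) := by
        rw [Finset.mul_sum]
        refine Finset.sum_le_sum fun k _ => ?_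
        rw [map_smul, innerSL_apply_apply, inner_e2_mulE_eq_evenCoeff, norm_smul, norm_mul]
        by_cases h : Even (N - k)
        · have hwN : w.val N ≤ w.val ((k + N) / 2) * w.val ((N - k) / 2) := by
            have := submultiplicative_half hw (a := 2 * N) (b := k + N) (by ring) h
            rwa [show 2 * N / 2 = N by omega] at this
          calc w.val N * (‖res n z k‖ * ‖inner ℂ (e2 k) u‖ * ‖evenCoeff q (N - k)‖)
              ≤ (w.val ((k + N) / 2) * w.val ((N - k) / 2)) *
                (1 / (2 * n) * ‖inner ℂ (e2 k) u‖ * ‖evenCoeff q (N - k)‖) := by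
                gcongr
                · exact mul_nonneg (w.nonneg _) (w.nonneg _)
                · exact norm_res_le (by omega) hz k
            _ = _ := by ring
        · simp [evenCoeff, h]
    _ ≤ 1 / (2 * n) * (2 * Q * Q) := by
        rw [← Finset.mul_sum]
        gcongr
    _ = Q ^ 2 / n := by field_simp

/-! ### Complex conjugation -/

open ComplexConjugate

theorem fourierCoeff_star (q : PerL2 1) (n : ℤ) :
    fourierCoeff (star q : PerL2 1) n = conj (fourierCoeff q (-n)) := by
  unfold fourierCoeff
  rw [← integral_conj]
  refine integral_congr_ae ?_
  filter_upwards [Lp.coeFn_star q] with x hx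
  rw [hx]
  simp

theorem norm_star_Lp (q : PerL2 1) : ‖(star q : PerL2 1)‖ = ‖q‖ := by
  have h : ∀ p : PerL2 1, ‖(star p : PerL2 1)‖ ≤ ‖p‖ := fun p => by
    refine Lp.norm_le_norm_of_ae_le ?_
    filter_upwards [Lp.coeFn_star p] with x hx
    rw [hx]
    simp
  refine le_antisymm (h q) ?_
  simpa using h (star q)

theorem isRealPotential_iff_star_eq (q : PerL2 1) : IsRealPotential q ↔ star q = q := by
  constructor
  · intro h
    refine Lp.ext ?_
    filter_upwards [h, Lp.coeFn_star q] with x hx hs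
    rw [hs]
    exact Complex.conj_eq_iff_im.2 hx
  · intro h
    have hs := Lp.coeFn_star q
    rw [h] at hs
    filter_upwards [hs] with x hx
    exact Complex.conj_eq_iff_im.1 hx.symm

theorem PerL2_ext {f g : PerL2 1} (h : ∀ n, fourierCoeff f n = fourierCoeff g n) : f = g := by
  apply (fourierBasis (T := (1 : ℝ))).repr.injective
  ext n
  rw [fourierBasis_repr, fourierBasis_repr, h n]

theorem evenCoeff_star (q : PerL2 1) (l : ℤ) :
    evenCoeff (star q) l = conj (evenCoeff q (-l)) := by
  unfold evenCoeff
  by_cases h : Even l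
  · have h' := h
    obtain ⟨j, hj⟩ := h'
    rw [if_pos h, if_pos (even_neg.2 h), fourierCoeff_star]
    congr 2
    omega
  · rw [if_neg h, if_neg (by rwa [even_neg]), map_zero]

theorem norm_evenCoeff_le (q : PerL2 1) (l : ℤ) : ‖evenCoeff q l‖ ≤ ‖q‖ := by
  have h := norm_inner_e2_le l (mulE q 0)
  rwa [inner_e2_mulE_eq_evenCoeff, sub_zero, norm_mulE] at h

theorem conj_mem_stripU {n : ℕ} {z : ℂ} (hz : z ∈ stripU n) : conj z ∈ stripU n := by
  change |(conj z).re - _| ≤ _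
  rw [Complex.conj_re]
  exact hz

theorem res_conj (n : ℕ) (z : ℂ) (k : ℤ) : res n (conj z) k = conj (res n z k) := by
  unfold res
  split_ifs
  · simp
  · simp [map_inv₀]

/-- A matrix `M` and its transpose have transposed perturbation series. -/
theorem eq_of_transposed_systems {M : ℤ → ℤ → ℂ} {C : ℝ} (hM : ∀ l k, ‖M l k‖ ≤ C)
    {x y u v : ℤ → ℂ} (hx : Summable fun k => ‖x k‖) (hy : Summable fun k => ‖y k‖) {i j : ℤ}
    (hu : ∀ l, u l = M l i + ∑' k, M l k * x k) (hv : ∀ l, v l = M j l + ∑' k, y k * M k l)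
    (hxy : ∀ l, y l * u l = x l * v l) : u j = v i := by
  have hbd : ∀ f : ℤ → ℂ, (Summable fun k => ‖f k‖) → ∀ g : ℤ → ℂ, (∀ k, ‖g k‖ ≤ C) →
      Summable fun k => f k * g k := fun f hf g hg =>
    Summable.of_norm_bounded (hf.mul_right C) fun k => by
      rw [norm_mul]; exact mul_le_mul_of_nonneg_left (hg k) (norm_nonneg _)
  have hdouble : Summable (Function.uncurry fun l k : ℤ => y l * M l k * x k) := by
    have h1 : Summable fun p : ℤ × ℤ => ‖y p.1‖ * ‖x p.2‖ * C :=
      (hy.mul_of_nonneg hx (fun _ => norm_nonneg _) fun _ => norm_nonneg _).mul_right C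
    refine Summable.of_norm_bounded h1 fun p => ?_
    simp only [Function.uncurry, norm_mul]
    calc _ ≤ ‖y p.1‖ * C * ‖x p.2‖ := by gcongr; exact hM _ _
      _ = _ := by ring
  have hrow : ∀ l, y l * ∑' k, M l k * x k = ∑' k, y l * M l k * x k := fun l => by
    rw [← tsum_mul_left]
    exact tsum_congr fun k => by ring
  have hcol : ∀ k, x k * ∑' l, y l * M l k = ∑' l, y l * M l k * x k := fun k => by
    rw [← tsum_mul_left]
    exact tsum_congr fun l => by ring
  have hsw : ∑' l, y l * ∑' k, M l k * x k = ∑' k, x k * ∑' l, y l * M l k := by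
    simp only [hrow, hcol]
    exact hdouble.tsum_comm.symm
  have hs1 : Summable fun l => y l * ∑' k, M l k * x k := by
    simp only [hrow]
    exact hdouble.prod
  have hs2 : Summable fun k => x k * ∑' l, y l * M l k := by
    simp only [hcol]
    exact hdouble.prod_symm.prod
  -- The sums `∑ y u` and `∑ x v` agree and both contain the double sum `∑ y M x`. Cancelling it
  -- leaves `∑ y_l M_{li} = ∑ M_{jl} x_l`, the corrections to the common leading term `M_{ji}`.
  have e1 : ∑' l, y l * u l = (∑' l, y l * M l i) + ∑' l, y l * ∑' k, M l k * x k := by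
    rw [← (hbd y hy (fun l => M l i) fun l => hM l i).tsum_add hs1]
    exact tsum_congr fun l => by rw [hu l]; ring
  have e2 : ∑' l, x l * v l = (∑' l, x l * M j l) + ∑' k, x k * ∑' l, y l * M l k := by
    rw [← (hbd x hx (fun l => M j l) fun l => hM j l).tsum_add hs2]
    exact tsum_congr fun l => by rw [hv l]; ring
  have e3 : ∑' l, y l * u l = ∑' l, x l * v l := tsum_congr hxy
  rw [e1, e2, hsw] at e3
  have e4 := add_right_cancel e3
  rw [hu j, hv i, e4]
  congr 1
  exact tsum_congr fun k => mul_comm _ _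

theorem inner_opTHat_mulE_eq {n : ℕ} (hn : 1024 ≤ n) {z : ℂ} (hz : z ∈ stripU n) {q : PerL2 1}
    (hq : 2048 * ‖q‖ ≤ n) (i l : ℤ) :
    inner ℂ (e2 l) (opTHat n z q (mulE q i)) = evenCoeff q (l - i) +
      ∑' k, evenCoeff q (l - k) * (res n z k * inner ℂ (e2 k) (opTHat n z q (mulE q i))) := by
  conv_lhs => rw [opTHat_apply_eq hn hz hq]
  rw [inner_add_right, inner_e2_mulE_eq_evenCoeff]
  congr 1
  rw [← innerSL_apply_apply,
    ← ((hasSum_res_smul_mulE n z q (opTHat n z q (mulE q i))).mapL (innerSL ℂ (e2 l))).tsum_eq]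
  refine tsum_congr fun k => ?_
  rw [map_smul, innerSL_apply_apply, inner_e2_mulE_eq_evenCoeff, smul_eq_mul, mul_comm]

/-- The adjoint of `(I - T_n)⁻¹ V` is the operator of the conjugate data. -/
theorem inner_opTHat_conj {n : ℕ} (hn : 1024 ≤ n) {z : ℂ} (hz : z ∈ stripU n) {q : PerL2 1}
    (hq : 2048 * ‖q‖ ≤ n) (i j : ℤ) :
    inner ℂ (e2 j) (opTHat n z q (mulE q i)) =
      conj (inner ℂ (e2 i) (opTHat n (conj z) (star q) (mulE (star q) j))) := by
  have hz' := conj_mem_stripU hz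
  have hq' : 2048 * ‖(star q : PerL2 1)‖ ≤ n := by rwa [norm_star_Lp]
  set u := opTHat n z q (mulE q i) with hu
  set v := opTHat n (conj z) (star q) (mulE (star q) j) with hv
  have hsum : ∀ f : PerL2 2, Summable fun k => ‖res n z k‖ * ‖inner ℂ (e2 k) f‖ := fun f =>
    Summable.of_nonneg_of_le (fun _ => by positivity)
      (fun k => mul_le_mul (norm_res_le_resBound (by omega) hz k) (norm_inner_e2_le k f)
        (norm_nonneg _) (resBound_nonneg n k)) ((hasSum_resBound n).summable.mul_right ‖f‖)
  -- Multiplication by an `L²` potential need not be bounded on `L²`, so the adjoint identity is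
  -- verified on matrix coefficients. These are bounded by `‖q‖`, and the resolvent factors make all
  -- sums absolutely convergent.
  refine eq_of_transposed_systems (M := fun l k => evenCoeff q (l - k)) (C := ‖q‖)
    (x := fun k => res n z k * inner ℂ (e2 k) u)
    (y := fun k => res n z k * conj (inner ℂ (e2 k) v))
    (u := fun l => inner ℂ (e2 l) u) (v := fun l => conj (inner ℂ (e2 l) v))
    (fun l k => norm_evenCoeff_le q _) (by simpa only [norm_mul] using hsum u)
    (by simpa only [norm_mul, RCLike.norm_conj] using hsum v)
    (fun l => inner_opTHat_mulE_eq hn hz hq i l) (fun l => ?_) (fun l => by ring)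
  rw [hv, inner_opTHat_mulE_eq hn hz' hq' j l, ← hv, map_add, evenCoeff_star, Complex.conj_conj,
    neg_sub, Complex.conj_tsum]
  congr 1
  refine tsum_congr fun k => ?_
  rw [map_mul, map_mul, evenCoeff_star, Complex.conj_conj, neg_sub, res_conj, Complex.conj_conj,
    mul_comm]

theorem coeffA_conj {n : ℕ} (hn : 1024 ≤ n) {z : ℂ} (hz : z ∈ stripU n) {q : PerL2 1}
    (hq : 2048 * ‖q‖ ≤ n) : coeffA n (conj z) (star q) = conj (coeffA n z q) := by
  have h := inner_opTHat_conj hn hz hq n n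
  unfold coeffA
  rw [h, Complex.conj_conj]

theorem coeffC_conj {n : ℤ} (hn : 1024 ≤ n.natAbs) {z : ℂ} (hz : z ∈ stripU n.natAbs)
    {q : PerL2 1} (hq : 2048 * ‖q‖ ≤ n.natAbs) :
    coeffC (-n) (conj z) (star q) = conj (coeffC n z q) := by
  have h := inner_opTHat_conj hn hz hq (-n) n
  unfold coeffC
  rw [h, Complex.conj_conj, Int.natAbs_neg, neg_neg]

theorem alphaN_star {n : ℕ} (hn : 1024 ≤ n) {q : PerL2 1} (hq : 2048 * ‖q‖ ≤ n) :
    alphaN n (star q) = conj (alphaN n q) := by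
  have hq' : 2048 * ‖(star q : PerL2 1)‖ ≤ n := by rwa [norm_star_Lp]
  have h := isDiagonalZero_alphaN hn hq
  refine (existsUnique_isDiagonalZero hn hq').unique (isDiagonalZero_alphaN hn hq')
    ⟨conj_mem_stripU h.1, ?_⟩
  rw [coeffA_conj hn h.1 hq]
  conv_lhs => rw [h.2]
  simp

/-- The size conditions beyond the cutoff. -/
theorem cutoff_bounds {m : ℝ} (hm : 1 ≤ m) {r : ℝ} (hr : r ≤ m / 2) {n : ℕ} (hn : cutoffM m ≤ n) :
    1024 ≤ n ∧ 2048 * r ≤ n := by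
  unfold cutoffM at hn
  -- The radius `m/2` is twice that of the ball `4‖q‖ ≤ m`, which leaves room for Cauchy estimates;
  -- `2048 r ≤ 1024 m ≤ 1024 m²` because `m ≥ 1`.
  have h1 : (1024 : ℝ) ≤ n := by nlinarith
  exact ⟨by exact_mod_cast h1, by nlinarith⟩

theorem phiCoeff_star {m : ℝ} (hm : 1 ≤ m) {q : PerL2 1} (hq : ‖q‖ ≤ m / 2) (n : ℤ) :
    phiCoeff m (star q) n = conj (phiCoeff m q (-n)) := by
  unfold phiCoeff
  rw [Int.natAbs_neg]
  split_ifs with h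
  · exact fourierCoeff_star q n
  · obtain ⟨h1, h2⟩ := cutoff_bounds hm hq (not_lt.1 h)
    rw [alphaN_star h1 h2]
    have h3 := coeffC_conj (n := -n) (by rwa [Int.natAbs_neg])
      (by rw [Int.natAbs_neg]; exact (isDiagonalZero_alphaN h1 h2).1) (by rwa [Int.natAbs_neg])
    rwa [neg_neg] at h3

/-! ### The spaces `H^w` -/

namespace Hw

variable {w : NormalizedWeight}

theorem norm_weightedCoeff (q : Hw w) : ‖weightedCoeff w q‖ = ‖q‖ := rfl

theorem weightedCoeff_apply (q : Hw w) (n : ℤ) :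
    weightedCoeff w q n = (w.val n : ℂ) * fourierCoeff q.toL2 n := rfl

theorem weight_ne_zero (w : NormalizedWeight) (n : ℤ) : (w.val n : ℂ) ≠ 0 := by
  have := w.one_le n
  exact_mod_cast (by linarith : (0 : ℝ) < w.val n).ne'

/-- `q ↦ (w_n q_n)` as an isometry. -/
noncomputable def weightedIsometry (w : NormalizedWeight) :
    Hw w →ₗᵢ[ℂ] lp (fun _ : ℤ => ℂ) 2 where
  toLinearMap := weightedCoeff w
  norm_map' := norm_weightedCoeff

/-- Weights are at least 1, so dividing by them preserves `ℓ²`; only the vanishing mean value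
restricts the range. The range is therefore closed, whence the completeness of `H^w`. -/
theorem mem_range_weightedIsometry (x : lp (fun _ : ℤ => ℂ) 2) :
    x ∈ LinearMap.range (weightedIsometry w).toLinearMap ↔ x 0 = 0 := by
  constructor
  · rintro ⟨q, rfl⟩
    change (w.val 0 : ℂ) * fourierCoeff q.toL2 0 = 0
    rw [show fourierCoeff q.toL2 0 = 0 from q.property.1, mul_zero]
  · intro hx
    have hmem : Memℓp (fun n : ℤ => (w.val n : ℂ)⁻¹ * x n) 2 := by
      refine (lp.memℓp x).mono' fun n => ?_
      rw [norm_mul, norm_inv, Complex.norm_of_nonneg (w.nonneg n)]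
      exact mul_le_of_le_one_left (norm_nonneg _) (inv_le_one_of_one_le₀ (w.one_le n))
    set f : PerL2 1 := (fourierBasis (T := (1 : ℝ))).repr.symm ⟨_, hmem⟩ with hf
    have hc : ∀ n, fourierCoeff f n = (w.val n : ℂ)⁻¹ * x n := fun n => by
      rw [← fourierBasis_repr, hf, LinearIsometryEquiv.apply_symm_apply]
    have hwc : ∀ n, (w.val n : ℂ) * fourierCoeff f n = x n := fun n => by
      rw [hc, mul_inv_cancel_left₀ (weight_ne_zero w n)]
    have hfm : f ∈ hwSubmodule w := by
      refine ⟨by rw [hc, hx, mul_zero], (memlp_weighted_iff w f).1 ?_⟩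
      simp only [hwc]
      exact lp.memℓp x
    refine ⟨⟨f, hfm⟩, ?_⟩
    ext n
    exact hwc n

theorem isClosed_range_weightedIsometry (w : NormalizedWeight) :
    IsClosed (LinearMap.range (weightedIsometry w).toLinearMap : Set (lp (fun _ : ℤ => ℂ) 2)) := by
  have h : (LinearMap.range (weightedIsometry w).toLinearMap : Set (lp (fun _ : ℤ => ℂ) 2)) =
      lp.evalCLM ℂ (fun _ : ℤ => ℂ) 2 0 ⁻¹' {0} := by
    ext x
    exact mem_range_weightedIsometry x
  rw [h]
  exact isClosed_singleton.preimage (lp.evalCLM ℂ (fun _ : ℤ => ℂ) 2 0).continuous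

instance (w : NormalizedWeight) :
    CompleteSpace (LinearMap.range (weightedIsometry w).toLinearMap) :=
  (isClosed_range_weightedIsometry w).completeSpace_coe

instance (w : NormalizedWeight) : CompleteSpace (Hw w) :=
  ((weightedIsometry w).equivRange.isometry.isUniformInducing.completeSpace_congr
    (weightedIsometry w).equivRange.surjective).2 inferInstance

/-- A left inverse of `q ↦ (w_n q_n)`. -/
noncomputable def ofWeightedCoeff (w : NormalizedWeight) :
    lp (fun _ : ℤ => ℂ) 2 →L[ℂ] Hw w :=
  ((weightedIsometry w).equivRange.symm.toContinuousLinearEquiv : _ →L[ℂ] Hw w).comp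
    (LinearMap.range (weightedIsometry w).toLinearMap).orthogonalProjectionOnto

theorem ofWeightedCoeff_weightedCoeff (q : Hw w) :
    ofWeightedCoeff w (weightedCoeff w q) = q := by
  have h1 : (LinearMap.range (weightedIsometry w).toLinearMap).orthogonalProjectionOnto
      (weightedCoeff w q) = (weightedIsometry w).equivRange q :=
    Submodule.orthogonalProjectionOnto_mem_subspace_eq_self ((weightedIsometry w).equivRange q)
  exact (congrArg (weightedIsometry w).equivRange.symm h1).trans
    ((weightedIsometry w).equivRange.symm_apply_apply q)

theorem weightedNormLE (q : Hw w) : WeightedNormLE w q.toL2 ‖q‖ := fun t => by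
  rw [norm_sq_eq]
  exact q.property.2.sum_le_tsum t fun _ _ => by positivity

end Hw

theorem norm_sq_eq_tsum_fourierCoeff (q : PerL2 1) :
    ‖q‖ ^ 2 = ∑' j : ℤ, ‖fourierCoeff q j‖ ^ 2 := by
  rw [← norm_mulE q 0, norm_mulE_sq]

namespace Hw

variable {w : NormalizedWeight}

theorem norm_toL2_le (q : Hw w) : ‖q.toL2‖ ≤ ‖q‖ := by
  rw [← sq_le_sq₀ (norm_nonneg _) (norm_nonneg _), norm_sq_eq_tsum_fourierCoeff, norm_sq_eq]
  refine (summable_sq_fourierCoeff q.toL2).tsum_le_tsum (fun n => ?_) q.property.2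
  exact le_mul_of_one_le_left (by positivity) (one_le_pow₀ (w.one_le n))

/-- The inclusion of `H^w` into `L²`. -/
noncomputable def toL2CLM (w : NormalizedWeight) : Hw w →L[ℂ] PerL2 1 :=
  LinearMap.mkContinuous
    { toFun := toL2
      map_add' := fun _ _ => rfl
      map_smul' := fun _ _ => rfl } 1 fun q => by
    rw [one_mul]; exact norm_toL2_le q

end Hw

/-! ### The map `Φ_m` -/

/-- `1 / |n|` beyond the cutoff. -/
noncomputable def cutoffTail (m : ℝ) (n : ℤ) : ℝ :=
  if (n.natAbs : ℝ) < cutoffM m then 0 else 1 / n.natAbs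

theorem cutoffTail_nonneg (m : ℝ) (n : ℤ) : 0 ≤ cutoffTail m n := by
  unfold cutoffTail
  split_ifs <;> positivity

theorem sum_nat_inv_sq_le {M : ℝ} (hM : 1 ≤ M) (t : Finset ℕ) :
    ∑ a ∈ t, (if (a : ℝ) < M then 0 else ((a : ℝ) ^ 2)⁻¹) ≤ 2 / M := by
  classical
  have hc : 1 ≤ ⌈M⌉₊ := Nat.one_le_ceil_iff.2 (by linarith)
  obtain ⟨K, hK⟩ : ∃ K, ∀ a ∈ t, a < K := ⟨t.sup id + 1, fun a ha =>
    Nat.lt_succ_of_le (Finset.le_sup (f := id) ha)⟩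
  calc ∑ a ∈ t, (if (a : ℝ) < M then 0 else ((a : ℝ) ^ 2)⁻¹)
      = ∑ a ∈ t.filter (fun a : ℕ => ¬ (a : ℝ) < M), ((a : ℝ) ^ 2)⁻¹ := by
        rw [Finset.sum_filter]
        exact Finset.sum_congr rfl fun a _ => by split_ifs <;> rfl
    _ ≤ ∑ a ∈ Finset.Ioo (⌈M⌉₊ - 1) K, ((a : ℝ) ^ 2)⁻¹ := by
        refine Finset.sum_le_sum_of_subset_of_nonneg (fun a ha => ?_) fun _ _ _ => by positivity
        obtain ⟨h1, h2⟩ := Finset.mem_filter.1 ha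
        have := Nat.ceil_le.2 (not_lt.1 h2)
        exact Finset.mem_Ioo.2 ⟨by omega, hK a h1⟩
    _ ≤ 2 / ((⌈M⌉₊ - 1 : ℕ) + 1) := sum_Ioo_inv_sq_le _ _
    _ ≤ 2 / M := by
        rw [Nat.cast_sub hc, Nat.cast_one, sub_add_cancel]
        exact div_le_div_of_nonneg_left (by norm_num) (by linarith) (Nat.le_ceil M)

/-- Each half-line contributes at most `2/M_m`, and `4/M_m = (1/(16m))²`: this is where the constant
`2¹⁰` enters the final bounds. -/
theorem sum_cutoffTail_sq_le {m : ℝ} (hm : 1 ≤ m) (t : Finset ℤ) :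
    ∑ n ∈ t, cutoffTail m n ^ 2 ≤ (1 / (16 * m)) ^ 2 := by
  classical
  have hM : 1 ≤ cutoffM m := by unfold cutoffM; nlinarith
  set g : ℕ → ℝ := fun a => if (a : ℝ) < cutoffM m then 0 else ((a : ℝ) ^ 2)⁻¹ with hg
  have hgt : ∀ n, cutoffTail m n ^ 2 = g n.natAbs := fun n => by
    simp only [cutoffTail, hg]
    split_ifs
    · simp
    · rw [one_div, inv_pow]
  have hhalf : ∀ s : Finset ℤ, Set.InjOn Int.natAbs s → ∑ n ∈ s, g n.natAbs ≤ 2 / cutoffM m :=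
    fun s hs => by
      rw [← Finset.sum_image (f := g) hs]
      exact sum_nat_inv_sq_le hM _
  simp only [hgt]
  rw [← Finset.sum_filter_add_sum_filter_not t (fun n => 0 ≤ n)]
  have h1 := hhalf (t.filter fun n => 0 ≤ n) fun a ha b hb hab => by
    simp only [Finset.coe_filter, Set.mem_ofPred_eq] at ha hb
    omega
  have h2 := hhalf (t.filter fun n => ¬ 0 ≤ n) fun a ha b hb hab => by
    simp only [Finset.coe_filter, Set.mem_ofPred_eq] at ha hb
    omega
  have h3 : 2 / cutoffM m + 2 / cutoffM m = (1 / (16 * m)) ^ 2 := by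
    unfold cutoffM
    field_simp
    norm_num
  linarith

theorem memlp_cutoffTail {m : ℝ} (hm : 1 ≤ m) :
    Memℓp (fun n : ℤ => (cutoffTail m n : ℂ)) 2 := by
  rw [memℓp_gen_iff (by norm_num)]
  refine summable_of_sum_le (c := (1 / (16 * m)) ^ 2) (fun _ => by positivity) fun t => ?_
  simpa using sum_cutoffTail_sq_le hm t

/-- The sequence `1 / |n|` beyond the cutoff, in `ℓ²`. -/
noncomputable def cutoffTailLp {m : ℝ} (hm : 1 ≤ m) : lp (fun _ : ℤ => ℂ) 2 :=
  ⟨fun n => (cutoffTail m n : ℂ), memlp_cutoffTail hm⟩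

theorem norm_cutoffTailLp_apply {m : ℝ} (hm : 1 ≤ m) (n : ℤ) :
    ‖cutoffTailLp hm n‖ = cutoffTail m n :=
  Complex.norm_of_nonneg (cutoffTail_nonneg m n)

theorem norm_cutoffTailLp_le {m : ℝ} (hm : 1 ≤ m) : ‖cutoffTailLp hm‖ ≤ 1 / (16 * m) := by
  refine lp.norm_le_of_forall_sum_le (by norm_num) (by positivity) fun t => ?_
  simpa [norm_cutoffTailLp_apply] using sum_cutoffTail_sq_le hm t

/-! ### The perturbation `Φ_m - I` on the ball of radius `m/2` -/

section PhiMap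

variable {m : ℝ} {w : NormalizedWeight} {q : Hw w}

theorem weight_mul_norm_phiCoeff_sub_le (hm : 1 ≤ m) (hw : w.Submultiplicative)
    (hq : ‖q‖ ≤ m / 2) (n : ℤ) :
    ‖(w.val n : ℂ) * (phiCoeff m q.toL2 n - fourierCoeff q.toL2 n)‖ ≤
      ‖q‖ ^ 2 * cutoffTail m n := by
  rw [norm_mul, Complex.norm_of_nonneg (w.nonneg n)]
  unfold phiCoeff cutoffTail
  split_ifs with h
  · simp
  · obtain ⟨h1, h2⟩ := cutoff_bounds hm hq (not_lt.1 h)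
    have h4 := (cutoff_bounds hm ((Hw.norm_toL2_le q).trans hq) (not_lt.1 h)).2
    rw [mul_one_div]
    exact weight_mul_norm_coeffC_sub_le hw (norm_nonneg q) q.weightedNormLE h1
      (isDiagonalZero_alphaN h1 h4).1 h4 h2

theorem memlp_weight_mul_phiCoeff (hm : 1 ≤ m) (hw : w.Submultiplicative) (hq : ‖q‖ ≤ m / 2) :
    Memℓp (fun n : ℤ => (w.val n : ℂ) * phiCoeff m q.toL2 n) 2 := by
  have h1 : Memℓp (fun n : ℤ => (w.val n : ℂ) *
      (phiCoeff m q.toL2 n - fourierCoeff q.toL2 n)) 2 := by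
    refine ((lp.memℓp (cutoffTailLp hm)).norm.const_smul (‖q‖ ^ 2)).mono fun n => ?_
    refine (weight_mul_norm_phiCoeff_sub_le hm hw hq n).trans_eq ?_
    rw [← norm_cutoffTailLp_apply hm]
    rfl
  convert h1.add (lp.memℓp (Hw.weightedCoeff w q)) using 1
  funext n
  rw [Pi.add_apply, Hw.weightedCoeff_apply]
  ring

theorem hasSum_phiCoeff (hm : 1 ≤ m) (hw : w.Submultiplicative) (hq : ‖q‖ ≤ m / 2) :
    ∃ f : PerL2 1, HasSum (fun n : ℤ => phiCoeff m q.toL2 n • (fourierLp 2 n : PerL2 1)) f ∧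
      ∀ n, fourierCoeff f n = phiCoeff m q.toL2 n := by
  have hmem : Memℓp (fun n : ℤ => phiCoeff m q.toL2 n) 2 := by
    refine (memlp_weight_mul_phiCoeff hm hw hq).mono' fun n => ?_
    rw [norm_mul, Complex.norm_of_nonneg (w.nonneg n)]
    exact le_mul_of_one_le_left (norm_nonneg _) (w.one_le n)
  refine ⟨(fourierBasis (T := (1 : ℝ))).repr.symm ⟨_, hmem⟩, ?_, fun n => ?_⟩
  · have h := (fourierBasis (T := (1 : ℝ))).hasSum_repr_symm ⟨_, hmem⟩
    rwa [coe_fourierBasis] at h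
  · rw [← fourierBasis_repr, LinearIsometryEquiv.apply_symm_apply]

theorem fourierCoeff_phiMap (hm : 1 ≤ m) (hw : w.Submultiplicative) (hq : ‖q‖ ≤ m / 2) (n : ℤ) :
    fourierCoeff (phiMap m q.toL2) n = phiCoeff m q.toL2 n := by
  obtain ⟨f, hf, hc⟩ := hasSum_phiCoeff hm hw hq
  rw [← hc n, ← hf.tsum_eq]
  rfl

theorem phiCoeff_zero (hm : 1 ≤ m) (q : PerL2 1) : phiCoeff m q 0 = fourierCoeff q 0 := by
  have hM : 0 < cutoffM m := by unfold cutoffM; positivity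
  exact if_pos (by simpa using hM)

theorem phiMap_mem_hwSubmodule (hm : 1 ≤ m) (hw : w.Submultiplicative) (hq : ‖q‖ ≤ m / 2) :
    phiMap m q.toL2 ∈ hwSubmodule w := by
  refine ⟨?_, (memlp_weighted_iff w _).1 ?_⟩
  · rw [fourierCoeff_phiMap hm hw hq, phiCoeff_zero hm]
    exact q.property.1
  · simp only [fourierCoeff_phiMap hm hw hq]
    exact memlp_weight_mul_phiCoeff hm hw hq

theorem toL2_phiMapW (hm : 1 ≤ m) (hw : w.Submultiplicative) (hq : ‖q‖ ≤ m / 2) :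
    (phiMapW m w q).toL2 = phiMap m q.toL2 := by
  have h : phiMapW m w q = ⟨phiMap m q.toL2, phiMap_mem_hwSubmodule hm hw hq⟩ := dif_pos _
  rw [h]
  rfl

theorem weightedCoeff_phiMapW_sub (hm : 1 ≤ m) (hw : w.Submultiplicative) (hq : ‖q‖ ≤ m / 2)
    (n : ℤ) : Hw.weightedCoeff w (phiMapW m w q - q) n =
      (w.val n : ℂ) * (phiCoeff m q.toL2 n - fourierCoeff q.toL2 n) := by
  rw [map_sub, lp.coeFn_sub, Pi.sub_apply, Hw.weightedCoeff_apply, Hw.weightedCoeff_apply,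
    toL2_phiMapW hm hw hq, fourierCoeff_phiMap hm hw hq, mul_sub]

theorem norm_phiMapW_sub_le (hm : 1 ≤ m) (hw : w.Submultiplicative) (hq : ‖q‖ ≤ m / 2) :
    ‖phiMapW m w q - q‖ ≤ ‖q‖ ^ 2 / (16 * m) := by
  rw [← Hw.norm_weightedCoeff]
  calc _ ≤ ‖q‖ ^ 2 * ‖cutoffTailLp hm‖ := by
        refine lp_norm_le_of_forall_le _ _ (by positivity) fun n => ?_
        rw [weightedCoeff_phiMapW_sub hm hw hq, norm_cutoffTailLp_apply]
        exact weight_mul_norm_phiCoeff_sub_le hm hw hq n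
    _ ≤ ‖q‖ ^ 2 * (1 / (16 * m)) := by gcongr; exact norm_cutoffTailLp_le hm
    _ = _ := by ring

theorem analyticAt_fourierCoeff (n : ℤ) (q : PerL2 1) :
    AnalyticAt ℂ (fun q : PerL2 1 => fourierCoeff q n) q := by
  have h : (fun q : PerL2 1 => fourierCoeff q n) =
      innerSL ℂ (fourierBasis (T := (1 : ℝ)) n) := by
    funext q
    rw [← fourierBasis_repr, HilbertBasis.repr_apply_apply]
    rfl
  rw [h]
  exact ContinuousLinearMap.analyticAt _ _

theorem analyticAt_phiCoeff (hm : 1 ≤ m) {q : PerL2 1} (hq : ‖q‖ < m / 2) (n : ℤ) :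
    AnalyticAt ℂ (fun q => phiCoeff m q n) q := by
  unfold phiCoeff
  split_ifs with h
  · exact analyticAt_fourierCoeff n q
  · obtain ⟨h1, h2⟩ := cutoff_bounds hm le_rfl (not_lt.1 h)
    exact analyticAt_coeffC_alphaN h1 (by linarith)

theorem analyticAt_phiMapW_sub (hm : 1 ≤ m) (hw : w.Submultiplicative) (hq : ‖q‖ < m / 2) :
    AnalyticAt ℂ (fun q => phiMapW m w q - q) q := by
  have hball : ∀ y ∈ Metric.ball q (m / 2 - ‖q‖), ‖y‖ < m / 2 := fun y hy => by
    rw [mem_ball_iff_norm] at hy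
    linarith [norm_le_norm_add_norm_sub' y q]
  have h1 : AnalyticAt ℂ (fun q => Hw.weightedCoeff w (phiMapW m w q - q)) q := by
    refine analyticAt_lp_of_dominated (((m / 2) ^ 2 : ℝ) • cutoffTailLp hm) (sub_pos.2 hq)
      (fun n y hy => ?_) fun n y hy => ?_
    · have h2 : AnalyticAt ℂ (fun q : Hw w =>
          (w.val n : ℂ) * (phiCoeff m q.toL2 n - fourierCoeff q.toL2 n)) y :=
        analyticAt_const.mul
          ((((analyticAt_phiCoeff hm ((Hw.norm_toL2_le y).trans_lt (hball y hy)) n).sub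
            (analyticAt_fourierCoeff n y.toL2))).comp (f := Hw.toL2CLM w)
              ((Hw.toL2CLM w).analyticAt y))
      refine h2.congr ?_
      filter_upwards [Metric.isOpen_ball.mem_nhds hy] with x hx
      exact (weightedCoeff_phiMapW_sub hm hw (hball x hx).le n).symm
    · rw [weightedCoeff_phiMapW_sub hm hw (hball y hy).le, lp.coeFn_smul, Pi.smul_apply, norm_smul,
        norm_cutoffTailLp_apply, Real.norm_of_nonneg (by positivity)]
      refine (weight_mul_norm_phiCoeff_sub_le hm hw (hball y hy).le n).trans ?_
      have := cutoffTail_nonneg m n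
      gcongr
      exact (hball y hy).le
  -- The continuous linear left inverse carries analyticity from `ℓ²` back to `H^w`.
  have h2 := ((Hw.ofWeightedCoeff w).analyticAt _).comp h1
  refine h2.congr (Filter.Eventually.of_forall fun y => ?_)
  exact Hw.ofWeightedCoeff_weightedCoeff _

/-- Cauchy's estimate: for `‖y‖ < m/2` the perturbation is at most `(m/2)²/(16m) = m/64`, so its
oscillation is at most `m/32`. -/
theorem norm_fderiv_phiMapW_sub_le (hm : 1 ≤ m) (hw : w.Submultiplicative) {r : ℝ} (hr : 0 < r)
    (hq : ‖q‖ ≤ m / 2 - r) :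
    ‖fderiv ℂ (fun q => phiMapW m w q - q) q‖ ≤ (m / 32) / r := by
  have hball : ∀ y ∈ Metric.ball q r, ‖y‖ < m / 2 := fun y hy => by
    rw [mem_ball_iff_norm] at hy
    linarith [norm_le_norm_add_norm_sub' y q]
  have hb : ∀ y ∈ Metric.ball q r, ‖phiMapW m w y - y‖ ≤ m / 64 := fun y hy => by
    refine (norm_phiMapW_sub_le hm hw (hball y hy).le).trans ?_
    rw [div_le_iff₀ (by positivity)]
    nlinarith [hball y hy, norm_nonneg y]
  refine Complex.norm_fderiv_le_div_of_mapsTo_ball (fun y hy =>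
    (analyticAt_phiMapW_sub hm hw (hball y hy)).differentiableAt.differentiableWithinAt)
    (fun y hy => ?_) hr
  rw [mem_closedBall_iff_norm]
  have h1 := hb y hy
  have h2 := hb q (Metric.mem_ball_self hr)
  linarith [norm_sub_le (phiMapW m w y - y) (phiMapW m w q - q)]

end PhiMap

/-! ### Perturbations of the identity -/

/-- An analytic perturbation of the identity with a small derivative on a ball is an analytic
diffeomorphism on every subset. -/
theorem isAnalyticDiffeoOnImage_of_norm_fderiv_le {E : Type*} [NormedAddCommGroup E]
    [NormedSpace ℂ E] [CompleteSpace E] {f : E → E} {R : ℝ}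
    (hf : ∀ x ∈ Metric.ball (0 : E) R, AnalyticAt ℂ (fun x => f x - x) x)
    (hd : ∀ x ∈ Metric.ball (0 : E) R, ‖fderiv ℂ (fun x => f x - x) x‖ ≤ 1 / 2) {s : Set E}
    (hs : s ⊆ Metric.ball 0 R) : IsAnalyticDiffeoOnImage f s := by
  have hfa : ∀ x ∈ Metric.ball (0 : E) R, AnalyticAt ℂ f x := fun x hx =>
    ((hf x hx).add analyticAt_id).congr (Filter.Eventually.of_forall fun y => by simp)
  have hinj : Set.InjOn f (Metric.ball 0 R) := by
    intro x hx y hy hxy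
    -- If `f x = f y`, the perturbation changes by exactly `x - y` up to sign, whereas its Lipschitz
    -- constant is `1/2`.
    have h1 := (convex_ball (0 : E) R).norm_image_sub_le_of_norm_fderiv_le
      (fun x hx => (hf x hx).differentiableAt) hd hx hy
    rw [hxy, sub_sub_sub_cancel_left, norm_sub_rev] at h1
    have : ‖y - x‖ = 0 := by linarith [norm_nonneg (y - x)]
    exact (sub_eq_zero.1 (norm_eq_zero.1 this)).symm
  refine ⟨fun x hx => hfa x (hs hx), hinj.mono hs,
    Function.invFunOn f (Metric.ball 0 R), ?_, fun x hx => hinj.leftInvOn_invFunOn (hs hx)⟩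
  rintro _ ⟨x, hx, rfl⟩
  have hxR := hs hx
  have hunit : IsUnit (fderiv ℂ f x) := by
    have h1 : fderiv ℂ f x = 1 - -fderiv ℂ (fun x => f x - x) x := by
      have h2 := (hf x hxR).differentiableAt.hasFDerivAt.add (hasFDerivAt_id x)
      have h3 : ((fun x => f x - x) + id : E → E) = f := by funext y; simp
      rw [h3] at h2
      rw [h2.fderiv, sub_neg_eq_add, add_comm]
      rfl
    rw [h1]
    refine isUnit_one_sub_of_norm_lt_one ?_
    rw [norm_neg]
    exact (hd x hxR).trans_lt (by norm_num)
  obtain ⟨u, hu⟩ := hunit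
  set e : E ≃L[ℂ] E := ContinuousLinearEquiv.ofUnit u with he
  have hfd : HasFDerivAt f (e : E →L[ℂ] E) x := by
    have h1 := (hfa x hxR).differentiableAt.hasFDerivAt
    rwa [← hu] at h1
  have hcd : ContDiffAt ℂ ⊤ f x := (hfa x hxR).contDiffAt
  set g := hcd.localInverse hfd (by simp) with hg
  have hga : AnalyticAt ℂ g (f x) := (hcd.to_localInverse hfd (by simp)).analyticAt
  have hgx : g (f x) = x := hcd.localInverse_apply_image hfd (by simp)
  have hri : ∀ᶠ y in nhds (f x), f (g y) = y :=
    (hcd.hasStrictFDerivAt' hfd (by simp)).eventually_right_inverse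
  have hmem : ∀ᶠ y in nhds (f x), g y ∈ Metric.ball 0 R :=
    hga.continuousAt.eventually_mem (by rw [hgx]; exact Metric.isOpen_ball.mem_nhds hxR)
  -- The local inverse takes values in the open ball, where `f` is injective; hence it coincides
  -- near `f x` with the global inverse, although `s` itself need not be open.
  refine hga.congr ?_
  filter_upwards [hri, hmem] with y hy1 hy2
  have h1 := hinj.leftInvOn_invFunOn hy2
  rw [hy1] at h1
  exact h1.symm

/-! ### Real potentials -/

/-- The trivial weight. -/
def NormalizedWeight.one : NormalizedWeight where
  val _ := 1
  symm _ := rfl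
  one_le _ := le_rfl

theorem NormalizedWeight.submultiplicative_one : NormalizedWeight.one.Submultiplicative :=
  fun _ _ => by simp [NormalizedWeight.one]

/-- Reduces the assertions about `L²` potentials to the trivial weight. -/
theorem exists_hw_one {q : PerL2 1} (h0 : fourierCoeff q 0 = 0) :
    ∃ p : Hw NormalizedWeight.one, p.toL2 = q ∧ ‖p‖ = ‖q‖ := by
  have hmem : q ∈ hwSubmodule NormalizedWeight.one :=
    ⟨h0, by simpa [NormalizedWeight.one] using summable_sq_fourierCoeff q⟩
  let p : Hw NormalizedWeight.one := ⟨q, hmem⟩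
  refine ⟨p, rfl, ?_⟩
  rw [← sq_eq_sq₀ (norm_nonneg _) (norm_nonneg _), Hw.norm_sq_eq, norm_sq_eq_tsum_fourierCoeff]
  refine tsum_congr fun n => ?_
  change (1 : ℝ) ^ 2 * _ = _
  rw [one_pow, one_mul]
  rfl

theorem isAnalyticDiffeoOnImage_phiMapW {m : ℝ} (hm : 1 ≤ m) {w : NormalizedWeight}
    (hw : w.Submultiplicative) : IsAnalyticDiffeoOnImage (phiMapW m w) (ballW w m) := by
  -- The radius `3m/8` lies midway between `m/4` and `m/2`: the open ball contains the closed ball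
  -- of radius `m/4`, and Cauchy's estimate with `r = m/8` gives `1/4 ≤ 1/2`.
  refine isAnalyticDiffeoOnImage_of_norm_fderiv_le (R := 3 * m / 8) (fun q hq => ?_)
    (fun q hq => ?_) fun q hq => ?_
  · rw [mem_ball_zero_iff] at hq
    exact analyticAt_phiMapW_sub hm hw (by linarith)
  · rw [mem_ball_zero_iff] at hq
    refine (norm_fderiv_phiMapW_sub_le hm hw (r := m / 8) (by positivity) (by linarith)).trans ?_
    rw [div_div_eq_mul_div, div_le_iff₀ (by positivity)]
    linarith
  · have hq' : 4 * ‖q‖ ≤ m := hq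
    rw [mem_ball_zero_iff]
    linarith

theorem isRealPotential_phiMap_iff {m : ℝ} (hm : 1 ≤ m) {q : PerL2 1} (hq : q ∈ ballO m) :
    IsRealPotential (phiMap m q) ↔ IsRealPotential q := by
  have hq2 : 4 * ‖q‖ ≤ m := hq.2
  have hw := NormalizedWeight.submultiplicative_one
  obtain ⟨p, hp, hpn⟩ := exists_hw_one hq.1
  have h0 : fourierCoeff (star q : PerL2 1) 0 = 0 := by
    rw [fourierCoeff_star, neg_zero, hq.1, map_zero]
  obtain ⟨p', hp', hpn'⟩ := exists_hw_one h0
  rw [norm_star_Lp] at hpn'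
  have hle : ‖p‖ ≤ m / 2 := by rw [hpn]; linarith
  have hle' : ‖p'‖ ≤ m / 2 := by rw [hpn']; linarith
  have hstar : (star (phiMap m q) : PerL2 1) = phiMap m (star q) := by
    refine PerL2_ext fun n => ?_
    rw [fourierCoeff_star, ← hp', fourierCoeff_phiMap hm hw hle', hp',
      phiCoeff_star hm (by linarith), ← hp, fourierCoeff_phiMap hm hw hle]
  rw [isRealPotential_iff_star_eq, isRealPotential_iff_star_eq, hstar]
  refine ⟨fun h => ?_, fun h => by rw [h]⟩
  -- If the image is real, `q` and its conjugate have the same image; injectivity on the ball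
  -- identifies them.
  have h1 : phiMapW m NormalizedWeight.one p' = phiMapW m NormalizedWeight.one p := by
    refine Subtype.ext ?_
    have h2 := toL2_phiMapW hm hw hle'
    rw [hp', h] at h2
    have h3 := toL2_phiMapW hm hw hle
    rw [hp] at h3
    exact h2.trans h3.symm
  have h2 := (isAnalyticDiffeoOnImage_phiMapW hm hw).2.1
    (show 4 * ‖p'‖ ≤ m by rwa [hpn']) (show 4 * ‖p‖ ≤ m by rwa [hpn]) h1
  rw [← hp', ← hp, h2]

theorem mainTheorem3 (m : ℝ) (hm : 1 ≤ m) :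
    (∀ q ∈ ballO m,
      (∀ n : ℕ, cutoffM m ≤ n →
        (∀ z ∈ stripU n, IsUnit (1 - opT n z q)) ∧ ∃! z : ℂ, IsDiagonalZero n q z) ∧
      Summable (fun n : ℤ => phiCoeff m q n • (fourierLp 2 n : PerL2 1)) ∧
      fourierCoeff (phiMap m q) 0 = 0 ∧
      (IsRealPotential (phiMap m q) ↔ IsRealPotential q)) ∧
    ∀ w : NormalizedWeight, w.Submultiplicative →
      (∀ q ∈ ballW w m, phiMap m q.toL2 ∈ hwSubmodule w) ∧
      IsAnalyticDiffeoOnImage (phiMapW m w) (ballW w m) ∧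
      (∀ q ∈ ballW w m,
        (1 / 2) * ‖q‖ ≤ ‖phiMapW m w q‖ ∧ ‖phiMapW m w q‖ ≤ 2 * ‖q‖) ∧
      ∀ q ∈ ballW w m,
        ‖fderiv ℂ (phiMapW m w) q - ContinuousLinearMap.id ℂ (Hw w)‖ ≤ 1 / 8 := by
  refine ⟨fun q hq => ?_, fun w hw => ?_⟩
  · have hq2 : 4 * ‖q‖ ≤ m := hq.2
    obtain ⟨p, rfl, hpn⟩ := exists_hw_one hq.1
    have hle : ‖p‖ ≤ m / 2 := by rw [hpn]; linarith
    have hone := NormalizedWeight.submultiplicative_one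
    refine ⟨fun n hn => ?_, ?_, (phiMap_mem_hwSubmodule hm hone hle).1,
      isRealPotential_phiMap_iff hm hq⟩
    · obtain ⟨h1, h2⟩ := cutoff_bounds hm (r := ‖p.toL2‖) (by linarith) hn
      exact ⟨fun z hz => isUnit_one_sub_opT h1 hz h2, existsUnique_isDiagonalZero h1 h2⟩
    · obtain ⟨f, hf, -⟩ := hasSum_phiCoeff hm hone hle
      exact hf.summable
  · have hball : ∀ q ∈ ballW w m, ‖q‖ ≤ m / 4 := fun q hq => by
      have hq' : 4 * ‖q‖ ≤ m := hq
      linarith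
    refine ⟨fun q hq => phiMap_mem_hwSubmodule hm hw (by linarith [hball q hq]),
      isAnalyticDiffeoOnImage_phiMapW hm hw, fun q hq => ?_, fun q hq => ?_⟩
    · have h1 := norm_phiMapW_sub_le hm hw (q := q) (by linarith [hball q hq])
      have h2 : ‖q‖ ^ 2 / (16 * m) ≤ ‖q‖ / 2 := by
        rw [div_le_iff₀ (by positivity)]
        nlinarith [hball q hq, norm_nonneg q]
      constructor
      · linarith [norm_le_norm_add_norm_sub' q (phiMapW m w q), norm_sub_rev q (phiMapW m w q)]
      · linarith [norm_le_norm_add_norm_sub' (phiMapW m w q) q, norm_nonneg q]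
    · have hq' := hball q hq
      have ha := analyticAt_phiMapW_sub hm hw (q := q) (by linarith)
      -- Balls of radius `m/4` about points of the ball stay within radius `m/2`, and `(m/32)/(m/4)
      -- = 1/8`.
      have h1 := norm_fderiv_phiMapW_sub_le hm hw (q := q) (r := m / 4) (by positivity)
        (by linarith)
      have h2 : fderiv ℂ (fun q => phiMapW m w q - q) q =
          fderiv ℂ (phiMapW m w) q - ContinuousLinearMap.id ℂ (Hw w) := by
        have hd : DifferentiableAt ℂ (phiMapW m w) q := by
          simpa using ha.differentiableAt.add differentiableAt_id
        exact (hd.hasFDerivAt.sub (hasFDerivAt_id q)).fderiv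
      rw [← h2]
      refine h1.trans_eq ?_
      field_simp
      norm_num
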